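/- Let $n\ge 2$. A properly convex projective $n$-manifold is a quotient $M=\Omega/\Gamma$, where $\Omega\subset\mathbb{RP}^n$ is open and properly convex (it meets every projective line in a connected, possibly empty, set, and its closure is contained in the complement of a projective hyperplane) and $\Gamma\subset PGL(n+1,\mathbb R)$ is a discrete torsion-free group preserving $\Omega$. The metric $d_M$ is induced by the Hilbert metric $d_\Omega(a,b)=\log\frac{\|b-x\|\,\|a-y\|}{\|b-y\|\,\|a-x\|}$ of $\Omega$, where $x,y\in\partial\Omega$ are the endpoints of the projective segment in $\overline{\Omega}$ through $a\neq b$, in the order $x,a,b,y$ (and $d_\Omega(a,a)=0$). The injectivity radius $\mathrm{inj}(p)\in(0,\infty]$ at $p\in M$ is the supremum of the radii $r$ of embedded metric balls in $M$ centred at $p$, that is, those $r$ for which the projection $\Omega\to M$ is injective on the ball of radius $r$ centred at a point that covers $p$. For each $n\ge 2$ there is a function $f:(0,\infty)\times[0,\infty)\to(0,\infty)$, strictly decreasing in its second variable, with the following property. Let $M$ be any properly convex projective $n$-manifold and let $p,q\in M$. If $\mathrm{inj}(p)$ is finite, then $$\mathrm{inj}(q)>f(\mathrm{inj}(p),d_M(p,q)),$$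 and if $\mathrm{inj}(p)=\infty$, then $\mathrm{inj}(q)=\infty$. -/

import Mathlib

open scoped LinearAlgebra.Projectivization ENNReal NNReal

noncomputable section

namespace ConvexProjective

/-- Real projective `n`-space, the set of lines through the origin of `ℝ^(n+1)`. -/
abbrev RP (n : ℕ) : Type := ℙ ℝ (Fin (n + 1) → ℝ)

/-- The group of projective transformations of `RP n`. -/
abbrev PGL (n : ℕ) : Type := Matrix.ProjGenLinGroup (Fin (n + 1)) ℝ

/-- The quotient topology on `RP n`. -/
instance instTopologicalSpaceRP (n : ℕ) : TopologicalSpace (RP n) :=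
  TopologicalSpace.coinduced
    (fun v : {v : Fin (n + 1) → ℝ // v ≠ 0} => Projectivization.mk ℝ v.1 v.2) inferInstance

/-- The quotient topology on `PGL n`. -/
instance instTopologicalSpacePGL (n : ℕ) : TopologicalSpace (PGL n) :=
  TopologicalSpace.coinduced
    (fun g : Matrix.GeneralLinearGroup (Fin (n + 1)) ℝ => Matrix.ProjGenLinGroup.mk g) inferInstance

variable {n : ℕ}

/-- The projectivization of a vector subspace. It is a projective line if the subspace has
dimension two. -/
def projSubspace (U : Submodule ℝ (Fin (n + 1) → ℝ)) : Set (RP n) :=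
  {p | p.submodule ≤ U}

/-- A subset of `RP n` is convex if its intersection with every projective line is connected
(possibly empty). -/
def IsConvex (C : Set (RP n)) : Prop :=
  ∀ U : Submodule ℝ (Fin (n + 1) → ℝ), Module.finrank ℝ U = 2 →
    IsPreconnected (C ∩ projSubspace U)

/-- The affine patch obtained from `RP n` by deleting the projective hyperplane `φ = 0`
(where `φ ≠ 0`). -/
def affinePatch (φ : Module.Dual ℝ (Fin (n + 1) → ℝ)) : Set (RP n) :=
  {p | φ p.rep ≠ 0}

/-- A subset of `RP n` is properly convex if it is convex and its closure is contained in an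
affine patch. -/
def IsProperlyConvex (C : Set (RP n)) : Prop :=
  IsConvex C ∧ ∃ φ : Module.Dual ℝ (Fin (n + 1) → ℝ), φ ≠ 0 ∧ closure C ⊆ affinePatch φ

/-- The coordinates of a point of the affine patch of `φ`: the representative on the affine
hyperplane `φ = 1`. -/
def affineRep (φ : Module.Dual ℝ (Fin (n + 1) → ℝ)) (p : RP n) : Fin (n + 1) → ℝ :=
  (φ p.rep)⁻¹ • p.rep

/-- The cross ratio `(‖b - x‖ ‖a - y‖) / (‖b - y‖ ‖a - x‖)` of four points on an affine line. On
collinear points it does not depend on the choice of the norm. -/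
def crossRatio (x a b y : Fin (n + 1) → ℝ) : ℝ :=
  (‖b - x‖ * ‖a - y‖) / (‖b - y‖ * ‖a - x‖)

/-- `r = log CR(x, a, b, y)`, where `x, y` are the points in which the projective line through the
distinct points `a, b` of `Ω` meets the boundary of `Ω`, in the order `x, a, b, y` along the
segment of this line in `closure Ω`; computed in any affine patch that contains `closure Ω`. -/
def IsLogCrossRatio (Ω : Set (RP n)) (a b : RP n) (r : ℝ) : Prop :=
  ∃ φ : Module.Dual ℝ (Fin (n + 1) → ℝ), closure Ω ⊆ affinePatch φ ∧
    ∃ x ∈ frontier Ω, ∃ y ∈ frontier Ω,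
      Sbtw ℝ (affineRep φ x) (affineRep φ a) (affineRep φ b) ∧
      Sbtw ℝ (affineRep φ a) (affineRep φ b) (affineRep φ y) ∧
      r = Real.log (crossRatio (affineRep φ x) (affineRep φ a) (affineRep φ b) (affineRep φ y))

open Classical in
/-- The Hilbert metric of an open properly convex set `Ω`. For distinct points `a, b` of `Ω`, the
set in the definition has exactly one element, by projective invariance of the cross ratio. -/
def hilbertDist (Ω : Set (RP n)) (a b : RP n) : ℝ :=
  if a = b then 0 else sSup {r : ℝ | IsLogCrossRatio Ω a b r}

/-- A properly convex projective `n`-manifold `M = Ω / Γ`: an open properly convex set `Ω` in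
`RP n` and a discrete torsion-free group `Γ` of projective transformations that preserve `Ω`. -/
structure ProperlyConvexManifold (n : ℕ) where
  Ω : Set (RP n)
  isOpen_Ω : IsOpen Ω
  isProperlyConvex_Ω : IsProperlyConvex Ω
  Γ : Subgroup (PGL n)
  smul_mem : ∀ γ ∈ Γ, ∀ p ∈ Ω, γ • p ∈ Ω
  discrete : DiscreteTopology Γ
  torsionFree : ∀ γ ∈ Γ, IsOfFinOrder γ → γ = 1

namespace ProperlyConvexManifold

variable (M : ProperlyConvexManifold n)

/-- The relation of lying in the same `Γ`-orbit. -/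
def orbitSetoid : Setoid M.Ω where
  r a b := ∃ γ ∈ M.Γ, γ • (a : RP n) = b
  iseqv :=
    { refl := fun a => ⟨1, M.Γ.one_mem, one_smul _ _⟩
      symm := by
        rintro a b ⟨γ, hγ, h⟩
        exact ⟨γ⁻¹, M.Γ.inv_mem hγ, by rw [← h, inv_smul_smul]⟩
      trans := by
        rintro a b c ⟨γ, hγ, h⟩ ⟨δ, hδ, k⟩
        exact ⟨δ * γ, M.Γ.mul_mem hδ hγ, by rw [mul_smul, h, k]⟩ }

/-- The points of `M = Ω / Γ`. -/
def Point : Type := Quotient M.orbitSetoid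

/-- The projection `Ω → M`. -/
def proj (a : M.Ω) : M.Point := Quotient.mk M.orbitSetoid a

/-- The metric `d_M` on `M` induced by the Hilbert metric of `Ω`: the least distance between
points of `Ω` that cover `p` and `q`. -/
def dist (p q : M.Point) : ℝ :=
  sInf {r : ℝ | ∃ a b : M.Ω, M.proj a = p ∧ M.proj b = q ∧ r = hilbertDist M.Ω a b}

/-- The metric ball of radius `r` in `M` centred at `p` is embedded: the projection `Ω → M` is
injective on the ball of radius `r` in `Ω` centred at any point that covers `p`. -/
def IsEmbeddedBall (p : M.Point) (r : ℝ) : Prop :=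
  ∀ a : M.Ω, M.proj a = p → Set.InjOn M.proj {b : M.Ω | hilbertDist M.Ω a b < r}

/-- The injectivity radius of `M` at `p`: the supremum of the radii of embedded metric balls
centred at `p`. It is infinite exactly when `Γ` is trivial. -/
def inj (p : M.Point) : ℝ≥0∞ :=
  ⨆ (r : ℝ≥0) (_ : M.IsEmbeddedBall p r), (r : ℝ≥0∞)

end ProperlyConvexManifold

end ConvexProjective

end

/-! The injectivity radius at a point is half of the least displacement of a lift by nontrivial
elements of `Γ` (`two_mul_le`, `isEmbeddedBall_of_le`), so it suffices to bound displacements at `q`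
from below. Suppose a nontrivial `γ` moves a lift `b` of `q` very little. Then the points `γ ^ k •
a`, with `a` a lift of `p` near `b` and `k ≤ N`, all stay in one ball about `b` of radius `D + 2`,
where `D` bounds the distance of `p` and `q`. If `N` is large, two of them are within `ℓ`, so the
power `γ ^ (j - i)`, nontrivial because `Γ` is torsion-free, moves `a` by at most `ℓ`. This
contradicts `ℓ ≤ inj p`.

The number `N` must not depend on `Ω`. Over `Ω` lies an open convex cone, and the Hilbert distance
of two rays is at most `log t` exactly when `u ≤ s v ≤ t u` for some `s > 0` in the cone order
(`hilbertDist_le_iff`). Suitably rescaled, the points of a ball about `u` lie in a multiple of the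
order interval `[-u, u]`, a symmetric convex body. Comparing volumes of its dilates bounds the
number of separated points by a constant that depends only on the dimension and the radii
(`exists_orderBound_of_many`).

Discreteness of `Γ` enters through compactness: elements with bounded displacement have lifts in a
compact subset of `GL`. With torsion-freeness this makes the action free and the injectivity radius
positive. -/

noncomputable section

namespace ConvexProjective

/-! ### Convex cones and the order description of Hilbert distance -/

section Cone

open scoped Pointwise

variable {E : Type*} [NormedAddCommGroup E] [NormedSpace ℝ E]

/-- An open convex cone on whose closure, away from the origin, `φ` is positive. -/
structure IsSharpCone (C : Set E) (φ : E →ₗ[ℝ] ℝ) : Prop where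
  isOpen : IsOpen C
  add_mem : ∀ u ∈ C, ∀ v ∈ C, u + v ∈ C
  smul_mem : ∀ t : ℝ, 0 < t → ∀ v ∈ C, t • v ∈ C
  pos : ∀ v ∈ closure C, v ≠ 0 → 0 < φ v
  zero_notMem : (0 : E) ∉ C

/-- `u ≤ s v ≤ t u` for some `s > 0`, in the order of the closure of the cone `C`: the Hilbert
distance of the rays of `u` and `v` is at most `log t`. -/
def OrderBound (C : Set E) (u v : E) (t : ℝ) : Prop :=
  ∃ s : ℝ, 0 < s ∧ s • v - u ∈ closure C ∧ t • u - s • v ∈ closure C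

variable {C : Set E} {φ : E →ₗ[ℝ] ℝ} {u v w : E} {s t : ℝ}

namespace IsSharpCone

theorem closure_add (hC : IsSharpCone C φ) (hu : u ∈ closure C) (hv : v ∈ closure C) :
    u + v ∈ closure C :=
  map_mem_closure₂ continuous_add hu hv hC.add_mem

theorem closure_smul (hC : IsSharpCone C φ) (ht : 0 ≤ t) (hu : u ∈ closure C) :
    t • u ∈ closure C := by
  have ht' : t ∈ closure (Set.Ioi (0 : ℝ)) := by rwa [closure_Ioi]
  exact map_mem_closure₂ continuous_smul ht' hu fun a ha b hb => hC.smul_mem a ha b hb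

theorem add_closure_mem (hC : IsSharpCone C φ) (hu : u ∈ C) (hv : v ∈ closure C) :
    u + v ∈ C := by
  have h : u + v ∈ C + closure C := Set.add_mem_add hu hv
  rw [hC.isOpen.add_closure] at h
  obtain ⟨a, ha, b, hb, hab⟩ := h
  rw [← hab]
  exact hC.add_mem a ha b hb

theorem zero_mem_closure (hC : IsSharpCone C φ) (hu : u ∈ C) : (0 : E) ∈ closure C := by
  simpa using hC.closure_smul le_rfl (subset_closure hu)

theorem ne_zero (hC : IsSharpCone C φ) (hu : u ∈ C) : u ≠ 0 :=
  fun h => hC.zero_notMem (h ▸ hu)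

theorem pos_of_mem (hC : IsSharpCone C φ) (hu : u ∈ C) : 0 < φ u :=
  hC.pos u (subset_closure hu) (hC.ne_zero hu)

theorem nonneg (hC : IsSharpCone C φ) (hu : u ∈ closure C) : 0 ≤ φ u := by
  by_cases h : u = 0
  · simp [h]
  · exact (hC.pos u hu h).le

/-- The closure of a sharp cone contains no line. -/
theorem nonneg_of_smul_mem (hC : IsSharpCone C φ) (hu : u ∈ C) (h : t • u ∈ closure C) :
    0 ≤ t := by
  have h1 := hC.nonneg h
  rw [map_smul, smul_eq_mul] at h1
  exact nonneg_of_mul_nonneg_left h1 (hC.pos_of_mem hu)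

end IsSharpCone

namespace OrderBound

theorem refl (hC : IsSharpCone C φ) (hu : u ∈ C) (ht : 1 ≤ t) : OrderBound C u u t := by
  refine ⟨1, one_pos, ?_, ?_⟩
  · simpa using hC.zero_mem_closure hu
  · rw [← sub_smul]
    exact hC.closure_smul (by linarith) (subset_closure hu)

theorem one_le (hC : IsSharpCone C φ) (hu : u ∈ C) (h : OrderBound C u v t) : 1 ≤ t := by
  obtain ⟨s, -, h1, h2⟩ := h
  have h3 := hC.closure_add h1 h2
  have h4 : (t - 1) • u ∈ closure C := by convert h3 using 1; module
  linarith [hC.nonneg_of_smul_mem hu h4]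

theorem symm (hC : IsSharpCone C φ) (ht : 0 < t) (h : OrderBound C u v t) :
    OrderBound C v u t := by
  obtain ⟨s, hs, h1, h2⟩ := h
  refine ⟨t / s, by positivity, ?_, ?_⟩
  · have h3 := hC.closure_smul (inv_nonneg.2 hs.le) h2
    convert h3 using 1
    rw [smul_sub, smul_smul, smul_smul, inv_mul_cancel₀ hs.ne', one_smul]
    congr 2; ring
  · have h3 := hC.closure_smul (div_nonneg ht.le hs.le) h1
    convert h3 using 1
    rw [smul_sub, smul_smul, div_mul_cancel₀ _ hs.ne']

/-- After taking logarithms this is the triangle inequality. -/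
theorem trans (hC : IsSharpCone C φ) (ht : 0 ≤ t) (h : OrderBound C u v s)
    (h' : OrderBound C v w t) : OrderBound C u w (s * t) := by
  obtain ⟨a, ha, h1, h2⟩ := h
  obtain ⟨b, hb, h3, h4⟩ := h'
  refine ⟨a * b, by positivity, ?_, ?_⟩
  · convert hC.closure_add h1 (hC.closure_smul ha.le h3) using 1; module
  · convert hC.closure_add (hC.closure_smul ht h2) (hC.closure_smul ha.le h4) using 1; module

theorem smul_left (hC : IsSharpCone C φ) {c : ℝ} (hc : 0 < c) (h : OrderBound C u v t) :
    OrderBound C (c • u) v t := by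
  obtain ⟨s, hs, h1, h2⟩ := h
  refine ⟨c * s, by positivity, ?_, ?_⟩
  · convert hC.closure_smul hc.le h1 using 1; module
  · convert hC.closure_smul hc.le h2 using 1; module

theorem smul_right {c : ℝ} (hc : 0 < c) (h : OrderBound C u v t) :
    OrderBound C u (c • v) t := by
  obtain ⟨s, hs, h1, h2⟩ := h
  refine ⟨s / c, by positivity, ?_, ?_⟩
  · rwa [smul_smul, div_mul_cancel₀ _ hc.ne']
  · rwa [smul_smul, div_mul_cancel₀ _ hc.ne']

theorem map {g : E →L[ℝ] E} (hg : ∀ x ∈ C, g x ∈ C) (h : OrderBound C u v t) :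
    OrderBound C (g u) (g v) t := by
  obtain ⟨s, hs, h1, h2⟩ := h
  refine ⟨s, hs, ?_, ?_⟩
  · simpa using map_mem_closure g.continuous h1 hg
  · simpa using map_mem_closure g.continuous h2 hg

/-- Two points at distance at most `log (t ^ 2)` have a midpoint. -/
theorem exists_midpoint (hC : IsSharpCone C φ) (hu : u ∈ C) (hv : v ∈ C) (ht : 0 < t)
    (h : OrderBound C u v (t ^ 2)) :
    ∃ m ∈ C, OrderBound C u m t ∧ OrderBound C m v t := by
  obtain ⟨s, hs, h1, h2⟩ := h
  -- With `u ≤ s v ≤ t² u`, each of the four required differences for this `m` is a positive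
  -- multiple of `s v - u` or of `t² u - s v`.
  refine ⟨t • u + s • v, hC.add_mem _ (hC.smul_mem t ht u hu) _ (hC.smul_mem s hs v hv),
    ⟨(t + 1)⁻¹, by positivity, ?_, ?_⟩, ⟨(t + 1) * s, by positivity, ?_, ?_⟩⟩
  · convert hC.closure_smul (t := (t + 1)⁻¹) (by positivity) h1 using 1
    match_scalars <;> field_simp
    all_goals ring
  · convert hC.closure_smul (t := (t + 1)⁻¹) (by positivity) h2 using 1
    match_scalars <;> field_simp
    all_goals ring
  · convert hC.closure_smul ht.le h1 using 1; module
  · convert h2 using 1; module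

end OrderBound

/-- Where the line through `a` and `b` leaves the cone determines the least multiple of `b` that
dominates `a`. -/
theorem IsSharpCone.smul_sub_mem_closure_iff (hC : IsSharpCone C φ) {a b : E} (hb : b ∈ C)
    {β : ℝ} (hβ : 1 < β) (hy : β • b - (β - 1) • a ∈ frontier C) :
    s • b - a ∈ closure C ↔ β / (β - 1) ≤ s := by
  have h0 : 0 < β - 1 := by linarith
  rw [hC.isOpen.frontier_eq] at hy
  constructor
  · intro h
    by_contra! hlt
    refine hy.2 ?_
    have h1 := hC.add_closure_mem (hC.smul_mem (β / (β - 1) - s) (by linarith) b hb) h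
    convert hC.smul_mem (β - 1) h0 _ h1 using 1
    match_scalars <;> field_simp
    all_goals ring
  · intro h
    have h1 := hC.closure_add (hC.closure_smul (inv_nonneg.2 h0.le) hy.1)
      (hC.closure_smul (sub_nonneg.2 h) (subset_closure hb))
    convert h1 using 1
    match_scalars <;> field_simp
    ring

/-- The exit point beyond `b` gives the lower bound `β / (β - 1)` for the scale `s`, and the one
beyond `a` gives the upper bound `t / (α / (α - 1))`. An admissible `s` exists exactly when these
are compatible; the product is the cross ratio, by `crossRatio_smul_sub`. -/
theorem IsSharpCone.orderBound_iff (hC : IsSharpCone C φ) {a b : E} (ha : a ∈ C) (hb : b ∈ C)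
    {α β : ℝ} (hα : 1 < α) (hβ : 1 < β) (hx : α • a - (α - 1) • b ∈ frontier C)
    (hy : β • b - (β - 1) • a ∈ frontier C) (ht : 0 < t) :
    OrderBound C a b t ↔ β / (β - 1) * (α / (α - 1)) ≤ t := by
  have hβ0 : 0 < β / (β - 1) := div_pos (by linarith) (by linarith)
  have key : ∀ s : ℝ, 0 < s → (t • a - s • b ∈ closure C ↔ α / (α - 1) ≤ t / s) := by
    intro s hs
    rw [← hC.smul_sub_mem_closure_iff ha hα hx]
    constructor
    · intro h
      convert hC.closure_smul (inv_nonneg.2 hs.le) h using 1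
      match_scalars <;> field_simp
    · intro h
      convert hC.closure_smul hs.le h using 1
      match_scalars <;> field_simp
  constructor
  · rintro ⟨s, hs, h1, h2⟩
    rw [hC.smul_sub_mem_closure_iff hb hβ hy] at h1
    rw [key s hs, le_div_iff₀ hs] at h2
    have : 0 < α / (α - 1) := div_pos (by linarith) (by linarith)
    nlinarith
  · intro h
    refine ⟨β / (β - 1), hβ0, ?_, ?_⟩
    · rw [hC.smul_sub_mem_closure_iff hb hβ hy]
    · rw [key _ hβ0, le_div_iff₀ hβ0]
      linarith

/-- The ray from `a` through `b` leaves the cone when `φ` is constant along it. -/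
theorem IsSharpCone.exists_frontier (hC : IsSharpCone C φ) {a b : E} (hb : b ∈ C)
    (hab : a ≠ b) (hφ : φ a = φ b) :
    ∃ β : ℝ, 1 < β ∧ β • b - (β - 1) • a ∈ frontier C := by
  have h1 : ∃ β : ℝ, 1 ≤ β ∧ β • b - (β - 1) • a ∉ C := by
    by_contra! hall
    -- A ray that never left `C` would have its direction `b - a` in the closure, where `φ` is
    -- positive; but `φ (b - a) = 0`.
    have hmem : b - a ∈ closure C := by
      have hlim : Filter.Tendsto (fun k : ℕ => (1 / ((k : ℝ) + 1)) • a + (b - a)) Filter.atTop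
          (nhds ((0 : ℝ) • a + (b - a))) :=
        ((tendsto_one_div_add_atTop_nhds_zero_nat (𝕜 := ℝ)).smul_const a).add_const _
      rw [zero_smul, zero_add] at hlim
      refine mem_closure_of_tendsto hlim (Filter.Eventually.of_forall fun k => ?_)
      have hk : (0 : ℝ) < k + 1 := by positivity
      convert hC.smul_mem _ (inv_pos.2 hk) _ (hall (k + 1) (by linarith)) using 1
      match_scalars
      · field_simp
        ring
      · field_simp
    have := hC.pos _ hmem (sub_ne_zero.2 hab.symm)
    simp [hφ] at this
  obtain ⟨β₁, hβ₁, hn⟩ := h1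
  let ℓ : ℝ → E := fun β => β • b - (β - 1) • a
  have hℓ : Continuous ℓ := by fun_prop
  have hpre : IsPreconnected (ℓ '' Set.Icc 1 β₁) := isPreconnected_Icc.image _ hℓ.continuousOn
  obtain ⟨y, ⟨β, hβ, rfl⟩, hy⟩ : (ℓ '' Set.Icc 1 β₁ ∩ frontier C).Nonempty := by
    rw [hC.isOpen.frontier_eq]
    by_contra hne
    have hsub := hpre.subset_of_closure_inter_subset hC.isOpen
      ⟨b, ⟨1, ⟨le_rfl, hβ₁⟩, by simp [ℓ]⟩, hb⟩ fun x hx => by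
        by_contra hxC
        exact hne ⟨x, hx.2, hx.1, hxC⟩
    exact hn (hsub ⟨β₁, ⟨hβ₁, le_rfl⟩, rfl⟩)
  refine ⟨β, lt_of_le_of_ne hβ.1 ?_, hy⟩
  rintro rfl
  rw [hC.isOpen.frontier_eq] at hy
  exact hy.2 (by simpa [ℓ] using hb)

end Cone

/-! ### Volume packing in a symmetric convex body -/

section Packing

open scoped Pointwise
open MeasureTheory

variable {E : Type*} [NormedAddCommGroup E] [NormedSpace ℝ E]

/-- Among sufficiently many points of `c • K`, two differ by an element of `ε • K`. -/
theorem exists_sub_mem_smul [FiniteDimensional ℝ E] {K : Set E} (hK : Convex ℝ K) (hKc : IsClosed K)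
    (hsymm : ∀ x ∈ K, -x ∈ K) (hbdd : Bornology.IsBounded K) (h0 : K ∈ nhds (0 : E))
    {c ε : ℝ} (hc : 0 < c) (hε : 0 < ε) {N : ℕ}
    (hN : ((c + ε / 2) / (ε / 2)) ^ Module.finrank ℝ E < N + 1)
    (x : Fin (N + 1) → E) (hx : ∀ i, x i ∈ c • K) :
    ∃ i j, i < j ∧ x i - x j ∈ ε • K := by
  borelize E
  by_contra! hne
  let μ : Measure E := Measure.addHaar
  have hδ : 0 < ε / 2 := by positivity
  have hsub : ∀ i j, i < j → Disjoint (x i +ᵥ (ε / 2) • K) (x j +ᵥ (ε / 2) • K) := by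
    -- A common point of two translates writes `x i - x j` as `ε` times the midpoint of `b` and
    -- `-a`, which lies in `K` by convexity and symmetry.
    intro i j hij
    rw [Set.disjoint_left]
    rintro _ ⟨_, ⟨a, ha, rfl⟩, rfl⟩ ⟨_, ⟨b, hb, rfl⟩, h⟩
    refine hne i j hij ⟨(1 / 2 : ℝ) • b + (1 / 2 : ℝ) • (-a),
      hK hb (hsymm a ha) (by norm_num) (by norm_num) (by norm_num), ?_⟩
    simp only [vadd_eq_add] at h ⊢
    have : x i - x j = (ε / 2) • b - (ε / 2) • a := by
      rw [sub_eq_sub_iff_add_eq_add, ← h, add_comm]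
    rw [this]
    module
  have hdisj : Pairwise (Function.onFun Disjoint fun i => x i +ᵥ (ε / 2) • K) := by
    intro i j hij
    rcases lt_or_gt_of_ne hij with h | h
    · exact hsub i j h
    · exact (hsub j i h).symm
  have hunion : (⋃ i, x i +ᵥ (ε / 2) • K) ⊆ (c + ε / 2) • K := by
    refine Set.iUnion_subset fun i => ?_
    rintro _ ⟨_, ⟨a, ha, rfl⟩, rfl⟩
    rw [hK.add_smul hc.le hδ.le]
    exact Set.add_mem_add (hx i) (Set.smul_mem_smul_set ha)
  have hmeas : ∀ i, MeasurableSet (x i +ᵥ (ε / 2) • K) := fun i =>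
    -- Disjointness gives `(N + 1) (ε / 2) ^ d ≤ (c + ε / 2) ^ d` for `d` the dimension, against
    -- `hN`; the volume of `K` cancels.
    ((hKc.smul₀ (ε / 2)).vadd (x i)).measurableSet
  have hvol := measure_mono (μ := μ) hunion
  rw [measure_iUnion hdisj hmeas] at hvol
  simp only [measure_vadd, tsum_fintype, Finset.sum_const, Finset.card_univ, Fintype.card_fin,
    Measure.addHaar_smul_of_nonneg μ hδ.le, Measure.addHaar_smul_of_nonneg μ (add_pos hc hδ).le,
    nsmul_eq_mul] at hvol
  have hpos : μ K ≠ 0 := (Measure.measure_pos_of_mem_nhds μ h0).ne'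
  have hfin : μ K ≠ ⊤ := hbdd.measure_lt_top.ne
  rw [← mul_assoc, ENNReal.mul_le_mul_iff_left hpos hfin,
    show ((N + 1 : ℕ) : ℝ≥0∞) = ENNReal.ofReal (N + 1) by
      rw [← Nat.cast_succ, ENNReal.ofReal_natCast],
    ← ENNReal.ofReal_mul (by positivity), ENNReal.ofReal_le_ofReal_iff (by positivity)] at hvol
  rw [div_pow, div_lt_iff₀ (by positivity)] at hN
  linarith

end Packing

/-! ### Order intervals and uniform total boundedness -/

section OrderInterval

open scoped Pointwise

/-- The order interval `[-u, u]` of the closure of the cone `C`. -/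
def orderInterval {E : Type*} [NormedAddCommGroup E] (C : Set E) (u : E) : Set E :=
  {w | u - w ∈ closure C ∧ u + w ∈ closure C}

theorem neg_mem_orderInterval {E : Type*} [NormedAddCommGroup E] {C : Set E} {u w : E}
    (h : w ∈ orderInterval C u) : -w ∈ orderInterval C u :=
  ⟨by simpa using h.2, by simpa [← sub_eq_add_neg] using h.1⟩

theorem isClosed_orderInterval {E : Type*} [NormedAddCommGroup E] {C : Set E} {u : E} :
    IsClosed (orderInterval C u) :=
  (isClosed_closure.preimage (continuous_const.sub continuous_id)).inter
    (isClosed_closure.preimage (continuous_const.add continuous_id))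

variable {E : Type*} [NormedAddCommGroup E] [NormedSpace ℝ E] {C : Set E} {φ : E →ₗ[ℝ] ℝ}
  {u w : E}

theorem mem_smul_orderInterval (hC : IsSharpCone C φ) {c : ℝ} (hc : 0 < c) :
    w ∈ c • orderInterval C u ↔ c • u - w ∈ closure C ∧ c • u + w ∈ closure C := by
  have key : ∀ x : E, u + c⁻¹ • x ∈ closure C ↔ c • u + x ∈ closure C := by
    intro x
    constructor
    · intro h
      convert hC.closure_smul hc.le h using 1
      match_scalars <;> field_simp
    · intro h
      convert hC.closure_smul (inv_nonneg.2 hc.le) h using 1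
      match_scalars <;> field_simp
  rw [Set.mem_smul_set_iff_inv_smul_mem₀ hc.ne']
  refine and_congr ?_ (key w)
  rw [sub_eq_add_neg, sub_eq_add_neg, ← smul_neg]
  exact key (-w)

namespace IsSharpCone

theorem convex_orderInterval (hC : IsSharpCone C φ) : Convex ℝ (orderInterval C u) := by
  intro x hx y hy a b ha hb hab
  have key : ∀ z w : E, u + z ∈ closure C → u + w ∈ closure C →
      u + (a • z + b • w) ∈ closure C := by
    intro z w hz hw
    convert hC.closure_add (hC.closure_smul ha hz) (hC.closure_smul hb hw) using 1
    rw [smul_add, smul_add, add_add_add_comm, ← add_smul, hab, one_smul]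
  refine ⟨?_, key _ _ hx.2 hy.2⟩
  have := key (-x) (-y) (by simpa [← sub_eq_add_neg] using hx.1)
    (by simpa [← sub_eq_add_neg] using hy.1)
  convert this using 1
  module

theorem orderInterval_mem_nhds (hC : IsSharpCone C φ) (hu : u ∈ C) :
    orderInterval C u ∈ nhds (0 : E) := by
  have h1 : ∀ᶠ w in nhds (0 : E), u - w ∈ C :=
    (continuous_const.sub continuous_id).continuousAt.preimage_mem_nhds
      (hC.isOpen.mem_nhds (by simpa using hu))
  have h2 : ∀ᶠ w in nhds (0 : E), u + w ∈ C :=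
    (continuous_const.add continuous_id).continuousAt.preimage_mem_nhds
      (hC.isOpen.mem_nhds (by simpa using hu))
  filter_upwards [h1, h2] with w hw1 hw2
  exact ⟨subset_closure hw1, subset_closure hw2⟩

/-- By compactness `φ` attains a positive minimum on the unit vectors of the closed cone;
homogeneity does the rest. This is what bounds order intervals. -/
theorem exists_norm_le [FiniteDimensional ℝ E] (hC : IsSharpCone C φ) :
    ∃ m : ℝ, 0 < m ∧ ∀ v ∈ closure C, m * ‖v‖ ≤ φ v := by
  have hcomp : IsCompact (closure C ∩ Metric.sphere (0 : E) 1) :=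
    (isCompact_sphere 0 1).inter_left isClosed_closure
  rcases (closure C ∩ Metric.sphere (0 : E) 1).eq_empty_or_nonempty with he | hne
  · refine ⟨1, one_pos, fun v hv => ?_⟩
    by_cases h : v = 0
    · simp [h]
    · exfalso
      refine Set.eq_empty_iff_forall_notMem.1 he (‖v‖⁻¹ • v)
        ⟨hC.closure_smul (by positivity) hv, ?_⟩
      simp [norm_smul, h]
  · obtain ⟨x, hx, hmin⟩ := hcomp.exists_isMinOn hne
      (LinearMap.continuous_of_finiteDimensional φ).continuousOn
    have hx0 : x ≠ 0 := by
      rintro rfl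
      simpa using hx.2
    refine ⟨φ x, hC.pos x hx.1 hx0, fun v hv => ?_⟩
    by_cases h : v = 0
    · simp [h]
    · have hv0 : 0 < ‖v‖ := norm_pos_iff.2 h
      have : φ x ≤ φ (‖v‖⁻¹ • v) := hmin
        ⟨hC.closure_smul (by positivity) hv, by simp [norm_smul, h]⟩
      rw [map_smul, smul_eq_mul, inv_mul_eq_div, le_div_iff₀ hv0] at this
      exact this

theorem isBounded_orderInterval [FiniteDimensional ℝ E] (hC : IsSharpCone C φ) :
    Bornology.IsBounded (orderInterval C u) := by
  obtain ⟨m, hm, h⟩ := hC.exists_norm_le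
  refine (Metric.isBounded_closedBall (x := -u) (r := 2 * φ u / m)).subset fun w hw => ?_
  rw [mem_closedBall_iff_norm, sub_neg_eq_add, add_comm, le_div_iff₀ hm]
  have h1 := hC.nonneg hw.1
  have h2 := h _ hw.2
  rw [map_sub] at h1
  rw [map_add] at h2
  linarith

end IsSharpCone

/-- Uniform total boundedness of the balls of all Hilbert geometries of a given dimension. -/
theorem exists_orderBound_of_many (E : Type*) [NormedAddCommGroup E] [NormedSpace ℝ E]
    [FiniteDimensional ℝ E] {c t : ℝ} (hc : 0 < c) (ht : 1 < t) :
    ∃ N : ℕ, ∀ (C : Set E) (φ : E →ₗ[ℝ] ℝ), IsSharpCone C φ → ∀ u ∈ C,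
      ∀ a : Fin (N + 1) → E, (∀ k, OrderBound C u (a k) c) →
        ∃ i j, i < j ∧ OrderBound C (a i) (a j) t := by
  -- Normalised points that differ by an element of `ε • [-u, u]` dominate each other up to the
  -- factor `1 + ε`, since `u` lies below each of them. Two such factors multiply to `t`.
  have hε : 0 < √t - 1 := by
    have : (1 : ℝ) < √t := by rw [Real.lt_sqrt zero_le_one]; simpa using ht
    linarith
  set ε := √t - 1 with hεd
  have htε : t = (1 + ε) * (1 + ε) := by
    rw [hεd, add_sub_cancel, Real.mul_self_sqrt (by linarith)]
  obtain ⟨N, hN⟩ := exists_nat_gt (((c + ε / 2) / (ε / 2)) ^ Module.finrank ℝ E)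
  refine ⟨N, fun C φ hC u hu a ha => ?_⟩
  choose s hs h1 h2 using ha
  obtain ⟨i, j, hij, h⟩ := exists_sub_mem_smul (hC.convex_orderInterval (u := u))
    isClosed_orderInterval (fun x => neg_mem_orderInterval) hC.isBounded_orderInterval
    (hC.orderInterval_mem_nhds hu) hc hε (by linarith) (fun k => s k • a k) (fun k => by
      rw [mem_smul_orderInterval hC hc]
      refine ⟨h2 k, ?_⟩
      convert hC.closure_add (hC.closure_add (h1 k) (subset_closure hu))
        (hC.closure_smul hc.le (subset_closure hu)) using 1
      module)
  rw [mem_smul_orderInterval hC hε] at h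
  refine ⟨i, j, hij, ?_⟩
  have hij1 : (1 + ε) • s j • a j - s i • a i ∈ closure C := by
    convert hC.closure_add h.1 (hC.closure_smul hε.le (h1 j)) using 1
    module
  have hij2 : (1 + ε) • s i • a i - s j • a j ∈ closure C := by
    convert hC.closure_add h.2 (hC.closure_smul hε.le (h1 i)) using 1
    module
  have key : OrderBound C (s i • a i) (s j • a j) t := by
    refine ⟨1 + ε, by positivity, hij1, ?_⟩
    convert hC.closure_smul (t := 1 + ε) (by positivity) hij2 using 1
    rw [htε]
    module
  have := (key.smul_left hC (inv_pos.2 (hs i))).smul_right (inv_pos.2 (hs j))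
  rwa [inv_smul_smul₀ (hs i).ne', inv_smul_smul₀ (hs j).ne'] at this

end OrderInterval

/-! ### The topology of projective space and the cone over a convex set -/

section ProjectiveTopology

open Topology

variable {n : ℕ} {Ω : Set (RP n)} {φ ψ : Module.Dual ℝ (Fin (n + 1) → ℝ)}
  {v w : Fin (n + 1) → ℝ}

theorem isQuotientMap_mk :
    IsQuotientMap (fun v : {v : Fin (n + 1) → ℝ // v ≠ 0} => Projectivization.mk ℝ v.1 v.2) :=
  ⟨⟨rfl⟩, fun p => ⟨⟨p.rep, p.rep_nonzero⟩, p.mk_rep⟩⟩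

/-- The saturation of an open set is the union of its rescalings, each of which is open. -/
theorem isOpenMap_mk :
    IsOpenMap (fun v : {v : Fin (n + 1) → ℝ // v ≠ 0} => Projectivization.mk ℝ v.1 v.2) := by
  intro U hU
  rw [← isQuotientMap_mk.isOpen_preimage]
  have : (fun v : {v : Fin (n + 1) → ℝ // v ≠ 0} => Projectivization.mk ℝ v.1 v.2) ⁻¹'
      ((fun v : {v : Fin (n + 1) → ℝ // v ≠ 0} => Projectivization.mk ℝ v.1 v.2) '' U) =
      ⋃ c : ℝˣ, (fun v : {v : Fin (n + 1) → ℝ // v ≠ 0} =>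
        (⟨c • v.1, (smul_ne_zero_iff_ne c).2 v.2⟩ : {v : Fin (n + 1) → ℝ // v ≠ 0})) ⁻¹' U := by
    ext v
    simp only [Set.mem_preimage, Set.mem_image, Set.mem_iUnion, Projectivization.mk_eq_mk_iff]
    constructor
    · rintro ⟨w, hw, c, hc⟩
      refine ⟨c, ?_⟩
      convert hw
    · rintro ⟨c, hc⟩
      exact ⟨_, hc, c, rfl⟩
  rw [this]
  refine isOpen_iUnion fun c => hU.preimage (Continuous.subtype_mk ?_ _)
  exact continuous_subtype_val.const_smul c

theorem mk_mem_affinePatch (hv : v ≠ 0) :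
    Projectivization.mk ℝ v hv ∈ affinePatch φ ↔ φ v ≠ 0 := by
  obtain ⟨c, hc⟩ := Projectivization.exists_smul_eq_mk_rep ℝ v hv
  rw [affinePatch, Set.mem_ofPred_eq, ← hc, Units.smul_def, map_smul, smul_eq_mul]
  simp

theorem affineRep_mk (hv : v ≠ 0) : affineRep φ (Projectivization.mk ℝ v hv) = (φ v)⁻¹ • v := by
  obtain ⟨c, hc⟩ := Projectivization.exists_smul_eq_mk_rep ℝ v hv
  rw [affineRep, ← hc, Units.smul_def, map_smul, smul_smul, smul_eq_mul, mul_inv, mul_comm,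
    ← mul_assoc, mul_inv_cancel₀ c.ne_zero, one_mul]

theorem apply_affineRep {p : RP n} (hp : p ∈ affinePatch φ) : φ (affineRep φ p) = 1 := by
  rw [affineRep, map_smul, smul_eq_mul, inv_mul_cancel₀ hp]

theorem affineRep_ne_zero {p : RP n} (hp : p ∈ affinePatch φ) : affineRep φ p ≠ 0 := by
  intro h
  simpa [h] using apply_affineRep hp

theorem mk_affineRep {p : RP n} (hp : p ∈ affinePatch φ) :
    Projectivization.mk ℝ (affineRep φ p) (affineRep_ne_zero hp) = p := by
  conv_rhs => rw [← p.mk_rep]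
  rw [Projectivization.mk_eq_mk_iff']
  exact ⟨_, rfl⟩

theorem mk_smul_eq {c : ℝ} (hc : c ≠ 0) (hv : v ≠ 0) :
    Projectivization.mk ℝ (c • v) (smul_ne_zero hc hv) = Projectivization.mk ℝ v hv := by
  rw [Projectivization.mk_eq_mk_iff']
  exact ⟨c, rfl⟩

/-- The part of the cone over `Ω` on which `φ` is positive. -/
def coneOver (φ : Module.Dual ℝ (Fin (n + 1) → ℝ)) (Ω : Set (RP n)) : Set (Fin (n + 1) → ℝ) :=
  {v | 0 < φ v ∧ ∃ h : v ≠ 0, Projectivization.mk ℝ v h ∈ Ω}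

theorem ne_zero_of_apply_pos (h : 0 < φ v) : v ≠ 0 := by
  rintro rfl
  simp at h

theorem continuous_halfSpace_mk (φ : Module.Dual ℝ (Fin (n + 1) → ℝ)) :
    Continuous fun v : {v // 0 < φ v} => Projectivization.mk ℝ v.1 (ne_zero_of_apply_pos v.2) :=
  isQuotientMap_mk.continuous.comp
    (Continuous.subtype_mk continuous_subtype_val fun v => ne_zero_of_apply_pos v.2)

theorem isOpen_halfSpace (φ : Module.Dual ℝ (Fin (n + 1) → ℝ)) : IsOpen {v | 0 < φ v} :=
  isOpen_lt continuous_const (LinearMap.continuous_of_finiteDimensional φ)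

theorem isOpenMap_halfSpace_mk (φ : Module.Dual ℝ (Fin (n + 1) → ℝ)) :
    IsOpenMap fun v : {v // 0 < φ v} =>
      Projectivization.mk ℝ v.1 (ne_zero_of_apply_pos v.2) := by
  intro U hU
  have hU' : IsOpen (Subtype.val '' U) := (isOpen_halfSpace φ).isOpenMap_subtype_val U hU
  convert isOpenMap_mk _ (hU'.preimage continuous_subtype_val) using 1
  ext p
  constructor
  · rintro ⟨v, hv, rfl⟩
    exact ⟨⟨v.1, ne_zero_of_apply_pos v.2⟩, ⟨v, hv, rfl⟩, rfl⟩
  · rintro ⟨⟨v, hv0⟩, ⟨w, hw, hvw⟩, rfl⟩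
    subst hvw
    exact ⟨w, hw, rfl⟩

theorem preimage_val_coneOver :
    (Subtype.val ⁻¹' coneOver φ Ω : Set {v // 0 < φ v}) =
      (fun v : {v // 0 < φ v} => Projectivization.mk ℝ v.1 (ne_zero_of_apply_pos v.2)) ⁻¹' Ω := by
  ext v
  exact ⟨fun h => h.2.2, fun h => ⟨v.2, _, h⟩⟩

/-- Preimages under continuous open maps commute with frontiers. Both the inclusion of the
half-space and its projection to `RP n` are of this kind. -/
theorem mk_mem_frontier_iff (hv : 0 < φ v) :
    Projectivization.mk ℝ v (ne_zero_of_apply_pos hv) ∈ frontier Ω ↔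
      v ∈ frontier (coneOver φ Ω) := by
  have h1 := (isOpen_halfSpace φ).isOpenMap_subtype_val.preimage_frontier_eq_frontier_preimage
    continuous_subtype_val (coneOver φ Ω)
  have h2 := (isOpenMap_halfSpace_mk φ).preimage_frontier_eq_frontier_preimage
    (continuous_halfSpace_mk φ) Ω
  exact Set.ext_iff.1 (h2.trans ((congrArg frontier preimage_val_coneOver.symm).trans h1.symm))
    ⟨v, hv⟩

theorem isOpen_coneOver (hΩ : IsOpen Ω) : IsOpen (coneOver φ Ω) := by
  have h := (isOpen_halfSpace φ).isOpenMap_subtype_val _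
    (hΩ.preimage (continuous_halfSpace_mk φ))
  rw [← preimage_val_coneOver] at h
  convert h using 1
  ext v
  exact ⟨fun hv => ⟨⟨v, hv.1⟩, hv, rfl⟩, by rintro ⟨w, hw, rfl⟩; exact hw⟩

theorem mk_mem_closure_of_mem (hv : v ≠ 0) (h : v ∈ closure (coneOver φ Ω)) :
    Projectivization.mk ℝ v hv ∈ closure Ω := by
  have hopen : IsOpenMap (Subtype.val : {v : Fin (n + 1) → ℝ // v ≠ 0} → _) :=
    isOpen_ne.isOpenMap_subtype_val
  have h1 := Set.ext_iff.1 (hopen.preimage_closure_eq_closure_preimage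
    continuous_subtype_val (coneOver φ Ω)) ⟨v, hv⟩
  exact map_mem_closure isQuotientMap_mk.continuous (h1.1 h) fun w hw => hw.2.2

theorem isOpen_affinePatch : IsOpen (affinePatch φ) := by
  rw [← isQuotientMap_mk.isOpen_preimage]
  have : ((fun v : {v : Fin (n + 1) → ℝ // v ≠ 0} => Projectivization.mk ℝ v.1 v.2) ⁻¹'
      affinePatch φ) = {v | φ v.1 ≠ 0} := by
    ext v
    exact mk_mem_affinePatch v.2
  rw [this]
  exact isOpen_ne_fun ((LinearMap.continuous_of_finiteDimensional φ).comp continuous_subtype_val)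
    continuous_const

theorem continuousOn_div :
    ContinuousOn (fun p : RP n => ψ p.rep / φ p.rep) (affinePatch φ) := by
  rw [isQuotientMap_mk.continuousOn_isOpen_iff isOpen_affinePatch]
  have hφ := LinearMap.continuous_of_finiteDimensional φ
  have hψ := LinearMap.continuous_of_finiteDimensional ψ
  have h : ContinuousOn (fun v : {v : Fin (n + 1) → ℝ // v ≠ 0} => ψ v.1 / φ v.1)
      {v | φ v.1 ≠ 0} :=
    (hψ.comp continuous_subtype_val).continuousOn.div
      (hφ.comp continuous_subtype_val).continuousOn fun v hv => hv
  refine (h.mono fun v hv => (mk_mem_affinePatch v.2).1 hv).congr fun v hv => ?_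
  obtain ⟨c, hc⟩ := Projectivization.exists_smul_eq_mk_rep ℝ v.1 v.2
  simp only [Function.comp]
  rw [← hc, Units.smul_def, map_smul, map_smul, smul_eq_mul, smul_eq_mul,
    mul_div_mul_left _ _ c.ne_zero]

theorem smul_mem_coneOver {t : ℝ} (ht : 0 < t) (hv : v ∈ coneOver φ Ω) : t • v ∈ coneOver φ Ω := by
  obtain ⟨h1, h2, h3⟩ := hv
  refine ⟨by rw [map_smul, smul_eq_mul]; positivity, smul_ne_zero ht.ne' h2, ?_⟩
  rwa [mk_smul_eq ht.ne' h2]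

theorem exists_dual_pair {u v : Fin (n + 1) → ℝ} (h : LinearIndependent ℝ ![u, v]) :
    ∃ ψ : Module.Dual ℝ (Fin (n + 1) → ℝ), ψ u = -1 ∧ ψ v = 1 := by
  rw [LinearIndependent.pair_iff] at h
  have h1 : v ∉ Submodule.span ℝ {u} := by
    rw [Submodule.mem_span_singleton]
    rintro ⟨c, hc⟩
    have := (h c (-1) (by rw [hc]; module)).2
    norm_num at this
  have h2 : u ∉ Submodule.span ℝ {v} := by
    rw [Submodule.mem_span_singleton]
    rintro ⟨c, hc⟩
    have := (h (-1) c (by rw [hc]; module)).1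
    norm_num at this
  obtain ⟨f, hf, hf'⟩ := Submodule.exists_dual_map_eq_bot_of_notMem h1 inferInstance
  obtain ⟨g, hg, hg'⟩ := Submodule.exists_dual_map_eq_bot_of_notMem h2 inferInstance
  have hfu : f u = 0 := by
    have := Submodule.mem_map_of_mem (f := f) (Submodule.mem_span_singleton_self (R := ℝ) u)
    rwa [hf', Submodule.mem_bot] at this
  have hgv : g v = 0 := by
    have := Submodule.mem_map_of_mem (f := g) (Submodule.mem_span_singleton_self (R := ℝ) v)
    rwa [hg', Submodule.mem_bot] at this
  refine ⟨(f v)⁻¹ • f - (g u)⁻¹ • g, ?_, ?_⟩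
  · simp [hfu, hg]
  · simp [hgv, hf]

/-- Choose `ψ` with `ψ u = -1` and `ψ v = 1`. On the connected set `Ω ∩ line` the continuous ratio
`ψ / φ` changes sign, hence vanishes somewhere, and `[u + v]` is the only zero of `ψ` on that line.
Parallel vectors are handled separately. -/
theorem add_mem_coneOver (hconv : IsConvex Ω) (hcl : closure Ω ⊆ affinePatch φ)
    {u v : Fin (n + 1) → ℝ} (hu : u ∈ coneOver φ Ω) (hv : v ∈ coneOver φ Ω) :
    u + v ∈ coneOver φ Ω := by
  by_cases hli : LinearIndependent ℝ ![u, v]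
  · obtain ⟨ψ, hψu, hψv⟩ := exists_dual_pair hli
    have hfin : Module.finrank ℝ (Submodule.span ℝ {u, v}) = 2 := by
      have := finrank_span_eq_card hli
      rwa [Matrix.range_cons_cons_empty, Fintype.card_fin] at this
    have hcont : ContinuousOn (fun p : RP n => ψ p.rep / φ p.rep)
        (Ω ∩ projSubspace (Submodule.span ℝ {u, v})) :=
      continuousOn_div.mono fun p hp => hcl (subset_closure hp.1)
    have hval : ∀ (w : Fin (n + 1) → ℝ) (hw : w ≠ 0),
        ψ (Projectivization.mk ℝ w hw).rep / φ (Projectivization.mk ℝ w hw).rep = ψ w / φ w := by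
      intro w hw
      obtain ⟨c, hc⟩ := Projectivization.exists_smul_eq_mk_rep ℝ w hw
      rw [← hc, Units.smul_def, map_smul, map_smul, smul_eq_mul, smul_eq_mul,
        mul_div_mul_left _ _ c.ne_zero]
    have hmem : ∀ (w : Fin (n + 1) → ℝ) (hw : w ≠ 0), w ∈ Submodule.span ℝ {u, v} →
        Projectivization.mk ℝ w hw ∈ projSubspace (Submodule.span ℝ {u, v}) := by
      intro w hw h
      rw [projSubspace, Set.mem_ofPred_eq, Projectivization.submodule_mk,
        Submodule.span_singleton_le_iff_mem]
      exact h
    obtain ⟨hφu, hu0, huΩ⟩ := hu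
    obtain ⟨hφv, hv0, hvΩ⟩ := hv
    have hivt := (hconv _ hfin).intermediate_value
      ⟨huΩ, hmem u hu0 (Submodule.subset_span (by simp))⟩
      ⟨hvΩ, hmem v hv0 (Submodule.subset_span (by simp))⟩ hcont
    rw [hval, hval, hψu, hψv] at hivt
    obtain ⟨p, ⟨hpΩ, hpU⟩, hp⟩ := hivt
      (show (0 : ℝ) ∈ Set.Icc (-1 / φ u) (1 / φ v) from
        ⟨div_nonpos_of_nonpos_of_nonneg (by norm_num) hφu.le, by positivity⟩)
    have hprep : p.rep ∈ Submodule.span ℝ {u, v} := by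
      rw [projSubspace, Set.mem_ofPred_eq, Projectivization.submodule_eq,
        Submodule.span_singleton_le_iff_mem] at hpU
      exact hpU
    have hψp : ψ p.rep = 0 := by
      rcases div_eq_zero_iff.1 hp with h | h
      · exact h
      · exact absurd h (hcl (subset_closure hpΩ))
    obtain ⟨a, b, hab⟩ := Submodule.mem_span_pair.1 hprep
    rw [← hab, map_add, map_smul, map_smul, hψu, hψv] at hψp
    have hba : b = a := by simp at hψp; linarith
    subst hba
    have hpos : 0 < φ (u + v) := by rw [map_add]; positivity
    refine ⟨hpos, ne_zero_of_apply_pos hpos, ?_⟩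
    convert hpΩ
    conv_rhs => rw [← p.mk_rep]
    rw [eq_comm, Projectivization.mk_eq_mk_iff']
    exact ⟨b, by rw [smul_add, hab]⟩
  · have hu0 : u ≠ 0 := hu.2.1
    rw [LinearIndependent.pair_iff' hu0] at hli
    push Not at hli
    obtain ⟨c, rfl⟩ := hli
    have hc : 0 < c := by
      have := hv.1
      rw [map_smul, smul_eq_mul] at this
      exact pos_of_mul_pos_left this hu.1.le
    have : u + c • u = (1 + c) • u := by module
    rw [this]
    exact smul_mem_coneOver (by positivity) hu

theorem isSharpCone_coneOver (hΩ : IsOpen Ω) (hconv : IsConvex Ω)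
    (hcl : closure Ω ⊆ affinePatch φ) : IsSharpCone (coneOver φ Ω) φ where
  isOpen := isOpen_coneOver hΩ
  add_mem _ hu _ hv := add_mem_coneOver hconv hcl hu hv
  smul_mem _ ht _ hv := smul_mem_coneOver ht hv
  pos v hv hv0 := by
    refine lt_of_le_of_ne ?_ ((mk_mem_affinePatch hv0).1 (hcl (mk_mem_closure_of_mem hv0 hv))).symm
    exact closure_minimal (t := {v | 0 ≤ φ v}) (fun w hw => hw.1.le)
      (isClosed_le continuous_const (LinearMap.continuous_of_finiteDimensional φ)) hv
  zero_notMem h := h.2.1 rfl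

end ProjectiveTopology

/-! ### The Hilbert metric through the cone order -/

section HilbertMetric

variable {n : ℕ} {Ω : Set (RP n)} {φ ψ : Module.Dual ℝ (Fin (n + 1) → ℝ)}
  {u v w : Fin (n + 1) → ℝ} {a b c : RP n} {r s : ℝ}

/-- If `ψ u < 0 < ψ v`, the positive combination `ψ v • u - ψ u • v` lies in `C` and is killed by
`ψ`. -/
theorem IsSharpCone.pos_or_neg {E : Type*} [NormedAddCommGroup E] [NormedSpace ℝ E] {C : Set E}
    {φ : E →ₗ[ℝ] ℝ} (hC : IsSharpCone C φ) {ψ : E →ₗ[ℝ] ℝ} (h : ∀ v ∈ C, ψ v ≠ 0) :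
    (∀ v ∈ C, 0 < ψ v) ∨ ∀ v ∈ C, ψ v < 0 := by
  by_contra! hne
  obtain ⟨⟨u, hu, hu'⟩, v, hv, hv'⟩ := hne
  have hu'' := lt_of_le_of_ne hu' (h u hu)
  have hv'' := lt_of_le_of_ne hv' (h v hv).symm
  refine h _ (hC.add_mem _ (hC.smul_mem (ψ v) hv'' u hu) _
    (hC.smul_mem (-ψ u) (by linarith) v hv)) ?_
  simp only [map_add, map_smul, smul_eq_mul]
  ring

theorem ne_zero_of_mem_coneOver (hcl : closure Ω ⊆ affinePatch ψ) (hv : v ∈ coneOver φ Ω) :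
    ψ v ≠ 0 :=
  (mk_mem_affinePatch hv.2.1).1 (hcl (subset_closure hv.2.2))

theorem coneOver_eq (hcl : closure Ω ⊆ affinePatch φ) (h : ∀ v ∈ coneOver φ Ω, 0 < ψ v) :
    coneOver ψ Ω = coneOver φ Ω := by
  ext v
  refine ⟨fun hv => ⟨?_, hv.2⟩, fun hv => ⟨h v hv, hv.2⟩⟩
  by_contra! hle
  have hlt := lt_of_le_of_ne hle (ne_zero_of_mem_coneOver hcl hv)
  have hneg : -v ∈ coneOver φ Ω := by
    refine ⟨by simpa using hlt, neg_ne_zero.2 hv.2.1, ?_⟩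
    have := mk_smul_eq (c := -1) (by norm_num) hv.2.1
    simp only [neg_smul, one_smul] at this
    rw [this]
    exact hv.2.2
  have := h _ hneg
  rw [map_neg] at this
  linarith [hv.1]

theorem affineRep_neg : affineRep (-φ) a = -affineRep φ a := by
  simp [affineRep, inv_neg]

theorem affinePatch_neg : affinePatch (-φ) = affinePatch φ := by
  simp [affinePatch]

theorem crossRatio_neg (x a b y : Fin (n + 1) → ℝ) :
    crossRatio (-x) (-a) (-b) (-y) = crossRatio x a b y := by
  have h : ∀ p q : Fin (n + 1) → ℝ, ‖-p - -q‖ = ‖p - q‖ := fun p q => by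
    rw [← neg_sub', norm_neg]
  simp only [crossRatio, h]

theorem sbtw_neg {E : Type*} [AddCommGroup E] [Module ℝ E] {x y z : E} (h : Sbtw ℝ x y z) :
    Sbtw ℝ (-x) (-y) (-z) := by
  obtain ⟨⟨t, ht, h1⟩, h2, h3⟩ := h
  refine ⟨⟨t, ht, ?_⟩, neg_injective.ne h2, neg_injective.ne h3⟩
  rw [← h1, AffineMap.lineMap_apply_module, AffineMap.lineMap_apply_module]
  module

theorem affineRep_mem_frontier {x : RP n} (hcl : closure Ω ⊆ affinePatch φ)
    (hx : x ∈ frontier Ω) : affineRep φ x ∈ frontier (coneOver φ Ω) := by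
  have hp := hcl (frontier_subset_closure hx)
  have h1 : 0 < φ (affineRep φ x) := by rw [apply_affineRep hp]; exact one_pos
  rw [← mk_mem_frontier_iff h1, mk_affineRep hp]
  exact hx

theorem Sbtw.exists_eq_smul_sub {E : Type*} [AddCommGroup E] [Module ℝ E] {x a b : E}
    (h : Sbtw ℝ x a b) : ∃ α : ℝ, 1 < α ∧ x = α • a - (α - 1) • b := by
  rw [sbtw_iff_mem_image_Ioo_and_ne] at h
  obtain ⟨⟨t, ⟨h0, h1⟩, rfl⟩, -⟩ := h
  have h2 : 0 < 1 - t := by linarith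
  refine ⟨1 / (1 - t), by rw [lt_div_iff₀ h2]; linarith, ?_⟩
  rw [AffineMap.lineMap_apply_module]
  match_scalars
  · field_simp
  · field_simp
    ring

theorem sbtw_of_eq_smul_sub {E : Type*} [AddCommGroup E] [Module ℝ E] {a b : E} {α : ℝ}
    (hα : 1 < α) (hab : a ≠ b) : Sbtw ℝ (α • a - (α - 1) • b) a b := by
  have h0 : 0 < α := by linarith
  rw [sbtw_iff_mem_image_Ioo_and_ne]
  refine ⟨⟨1 - 1 / α, ⟨?_, ?_⟩, ?_⟩, ?_⟩
  · rw [sub_pos, div_lt_one h0]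
    exact hα
  · have : 0 < 1 / α := by positivity
    linarith
  · rw [AffineMap.lineMap_apply_module]
    match_scalars
    · field_simp
      ring
    · field_simp
      ring
  · intro h
    apply hab
    have : α • (a - b) = 0 := by
      rw [← sub_eq_zero] at h
      rw [← h]
      module
    rcases smul_eq_zero.1 this with h | h
    · linarith
    · exact sub_eq_zero.1 h

theorem crossRatio_smul_sub {a b : Fin (n + 1) → ℝ} {α β : ℝ} (hα : 1 < α) (hβ : 1 < β)
    (hab : a ≠ b) :
    crossRatio (α • a - (α - 1) • b) a b (β • b - (β - 1) • a) =
      β / (β - 1) * (α / (α - 1)) := by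
  have h1 : b - (α • a - (α - 1) • b) = α • (b - a) := by module
  have h2 : a - (β • b - (β - 1) • a) = (-β) • (b - a) := by module
  have h3 : b - (β • b - (β - 1) • a) = (-(β - 1)) • (b - a) := by module
  have h4 : a - (α • a - (α - 1) • b) = (α - 1) • (b - a) := by module
  have h5 : ‖b - a‖ ≠ 0 := norm_ne_zero_iff.2 (sub_ne_zero.2 hab.symm)
  rw [crossRatio, h1, h2, h3, h4]
  simp only [norm_smul, norm_neg, Real.norm_eq_abs]
  rw [abs_of_pos (show 0 < α by linarith), abs_of_pos (show 0 < α - 1 by linarith),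
    abs_of_pos (show 0 < β by linarith), abs_of_pos (show 0 < β - 1 by linarith)]
  have : α - 1 ≠ 0 := by linarith
  have : β - 1 ≠ 0 := by linarith
  field_simp

theorem orderBound_smul_iff {C : Set (Fin (n + 1) → ℝ)} (hC : IsSharpCone C φ) {c d t : ℝ}
    (hc : 0 < c) (hd : 0 < d) : OrderBound C (c • u) (d • v) t ↔ OrderBound C u v t := by
  constructor
  · intro h
    have := (h.smul_left hC (inv_pos.2 hc)).smul_right (inv_pos.2 hd)
    rwa [inv_smul_smul₀ hc.ne', inv_smul_smul₀ hd.ne'] at this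
  · intro h
    exact (h.smul_left hC hc).smul_right hd

/-- An open properly convex set with the choice of an affine patch that contains its closure. -/
structure IsConvexInPatch (Ω : Set (RP n)) (φ : Module.Dual ℝ (Fin (n + 1) → ℝ)) : Prop where
  isOpen : IsOpen Ω
  isConvex : IsConvex Ω
  closure_subset : closure Ω ⊆ affinePatch φ

namespace IsConvexInPatch

theorem isSharpCone (h : IsConvexInPatch Ω φ) : IsSharpCone (coneOver φ Ω) φ :=
  isSharpCone_coneOver h.isOpen h.isConvex h.closure_subset

/-- The right side mentions neither `r` nor the patch used to compute it, so this also shows that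
the logarithm of the cross ratio is unique. -/
theorem log_crossRatio_le_iff (h : IsConvexInPatch Ω φ) (hu : u ∈ coneOver φ Ω)
    (hv : v ∈ coneOver φ Ω)
    (hr : IsLogCrossRatio Ω (Projectivization.mk ℝ u hu.2.1) (Projectivization.mk ℝ v hv.2.1) r) :
    r ≤ s ↔ OrderBound (coneOver φ Ω) u v (Real.exp s) := by
  obtain ⟨ψ, hψ, x, hx, y, hy, hxab, haby, rfl⟩ := hr
  -- Passing to `-ψ` negates all affine representatives and leaves the cross ratio unchanged; once
  -- `ψ` is positive, both functionals define the same cone.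
  wlog hpos : ∀ w ∈ coneOver φ Ω, 0 < ψ w generalizing ψ
  · have hneg := (h.isSharpCone.pos_or_neg fun w hw => ne_zero_of_mem_coneOver hψ hw).resolve_left
      hpos
    have := this (-ψ) (by rwa [affinePatch_neg]) (by simpa only [affineRep_neg] using sbtw_neg hxab)
      (by simpa only [affineRep_neg] using sbtw_neg haby)
      (fun w hw => by simpa using hneg w hw)
    simpa only [affineRep_neg, crossRatio_neg] using this
  have hx' := affineRep_mem_frontier hψ hx
  have hy' := affineRep_mem_frontier hψ hy
  rw [coneOver_eq h.closure_subset hpos] at hx' hy'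
  obtain ⟨α, hα, hxe⟩ := Sbtw.exists_eq_smul_sub hxab
  obtain ⟨β, hβ, hye⟩ := Sbtw.exists_eq_smul_sub haby.symm
  have hab := hxab.ne_right
  rw [hxe] at hx'
  rw [hye] at hy'
  rw [hxe, hye]
  rw [crossRatio_smul_sub hα hβ hab]
  rw [affineRep_mk, affineRep_mk] at hx' hy'
  have hu1 : 0 < (ψ u)⁻¹ := inv_pos.2 (hpos u hu)
  have hv1 : 0 < (ψ v)⁻¹ := inv_pos.2 (hpos v hv)
  rw [← orderBound_smul_iff h.isSharpCone hu1 hv1,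
    h.isSharpCone.orderBound_iff (smul_mem_coneOver hu1 hu) (smul_mem_coneOver hv1 hv) hα hβ hx'
      hy' (Real.exp_pos s), Real.log_le_iff_le_exp]
  have : 0 < α - 1 := by linarith
  have : 0 < β - 1 := by linarith
  positivity

theorem exists_isLogCrossRatio (h : IsConvexInPatch Ω φ) (ha : a ∈ Ω) (hb : b ∈ Ω)
    (hab : a ≠ b) : ∃ r, IsLogCrossRatio Ω a b r := by
  have hcl := h.closure_subset
  have ha' := hcl (subset_closure ha)
  have hb' := hcl (subset_closure hb)
  have hmem : ∀ {c}, c ∈ Ω → affineRep φ c ∈ coneOver φ Ω := by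
    intro c hc
    have hc' := hcl (subset_closure hc)
    refine ⟨by rw [apply_affineRep hc']; exact one_pos, affineRep_ne_zero hc', ?_⟩
    rwa [mk_affineRep hc']
  have hne : affineRep φ a ≠ affineRep φ b := by
    intro he
    apply hab
    rw [← mk_affineRep ha', ← mk_affineRep hb']
    simp only [he]
  have hφ : φ (affineRep φ a) = φ (affineRep φ b) := by
    rw [apply_affineRep ha', apply_affineRep hb']
  have key : ∀ {p q : Fin (n + 1) → ℝ} {β : ℝ}, φ p = 1 → φ q = 1 →
      β • q - (β - 1) • p ∈ frontier (coneOver φ Ω) →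
      ∃ y ∈ frontier Ω, affineRep φ y = β • q - (β - 1) • p := by
    intro p q β hp hq hf
    have h1 : φ (β • q - (β - 1) • p) = 1 := by
      rw [map_sub, map_smul, map_smul, hp, hq]
      simp
    have h2 : 0 < φ (β • q - (β - 1) • p) := by rw [h1]; exact one_pos
    refine ⟨_, (mk_mem_frontier_iff h2).2 hf, ?_⟩
    rw [affineRep_mk, h1, inv_one, one_smul]
  obtain ⟨β, hβ, hβf⟩ := h.isSharpCone.exists_frontier (hmem hb) hne hφ
  obtain ⟨α, hα, hαf⟩ := h.isSharpCone.exists_frontier (hmem ha) hne.symm hφ.symm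
  obtain ⟨y, hy, hye⟩ := key (apply_affineRep ha') (apply_affineRep hb') hβf
  obtain ⟨x, hx, hxe⟩ := key (apply_affineRep hb') (apply_affineRep ha') hαf
  refine ⟨_, φ, hcl, x, hx, y, hy, ?_, ?_, rfl⟩
  · rw [hxe]
    exact sbtw_of_eq_smul_sub hα hne
  · rw [hye]
    exact (sbtw_of_eq_smul_sub hβ hne.symm).symm

theorem hilbertDist_le_iff (h : IsConvexInPatch Ω φ) (hu : u ∈ coneOver φ Ω)
    (hv : v ∈ coneOver φ Ω) :
    hilbertDist Ω (Projectivization.mk ℝ u hu.2.1) (Projectivization.mk ℝ v hv.2.1) ≤ r ↔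
      OrderBound (coneOver φ Ω) u v (Real.exp r) := by
  by_cases hab : Projectivization.mk ℝ u hu.2.1 = Projectivization.mk ℝ v hv.2.1
  · rw [hilbertDist, if_pos hab]
    obtain ⟨c, rfl⟩ := (Projectivization.mk_eq_mk_iff' ℝ u v hu.2.1 hv.2.1).1 hab
    have hc : 0 < c := by
      have := hu.1
      rw [map_smul, smul_eq_mul] at this
      exact pos_of_mul_pos_left this hv.1.le
    rw [← one_smul ℝ v, smul_smul, orderBound_smul_iff h.isSharpCone (by simpa using hc) one_pos]
    rw [← Real.one_le_exp_iff]
    exact ⟨fun hr => OrderBound.refl h.isSharpCone hv hr, fun hr => hr.one_le h.isSharpCone hv⟩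
  · obtain ⟨r₀, hr₀⟩ := h.exists_isLogCrossRatio hu.2.2 hv.2.2 hab
    have hset : {r | IsLogCrossRatio Ω (Projectivization.mk ℝ u hu.2.1)
        (Projectivization.mk ℝ v hv.2.1) r} = {r₀} := by
      ext r₁
      refine ⟨fun hr₁ => ?_, fun hr₁ => hr₁ ▸ hr₀⟩
      exact le_antisymm
        ((h.log_crossRatio_le_iff hu hv hr₁).2 ((h.log_crossRatio_le_iff hu hv hr₀).1 le_rfl))
        ((h.log_crossRatio_le_iff hu hv hr₀).2 ((h.log_crossRatio_le_iff hu hv hr₁).1 le_rfl))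
    rw [hilbertDist, if_neg hab, hset, csSup_singleton]
    exact h.log_crossRatio_le_iff hu hv hr₀

theorem exists_mk_eq (h : IsConvexInPatch Ω φ) (ha : a ∈ Ω) :
    ∃ (u : Fin (n + 1) → ℝ) (hu : u ∈ coneOver φ Ω), Projectivization.mk ℝ u hu.2.1 = a := by
  have ha' := h.closure_subset (subset_closure ha)
  refine ⟨affineRep φ a, ⟨by rw [apply_affineRep ha']; exact one_pos, affineRep_ne_zero ha', ?_⟩,
    mk_affineRep ha'⟩
  rwa [mk_affineRep ha']

theorem hilbertDist_nonneg (h : IsConvexInPatch Ω φ) (ha : a ∈ Ω) (hb : b ∈ Ω) :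
    0 ≤ hilbertDist Ω a b := by
  obtain ⟨u, hu, rfl⟩ := h.exists_mk_eq ha
  obtain ⟨v, hv, rfl⟩ := h.exists_mk_eq hb
  have := (h.hilbertDist_le_iff hu hv).1 le_rfl
  exact Real.one_le_exp_iff.1 (this.one_le h.isSharpCone hu)

theorem hilbertDist_comm (h : IsConvexInPatch Ω φ) (ha : a ∈ Ω) (hb : b ∈ Ω) :
    hilbertDist Ω a b = hilbertDist Ω b a := by
  obtain ⟨u, hu, rfl⟩ := h.exists_mk_eq ha
  obtain ⟨v, hv, rfl⟩ := h.exists_mk_eq hb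
  refine le_antisymm ?_ ?_
  · rw [h.hilbertDist_le_iff hu hv]
    exact ((h.hilbertDist_le_iff hv hu).1 le_rfl).symm h.isSharpCone (Real.exp_pos _)
  · rw [h.hilbertDist_le_iff hv hu]
    exact ((h.hilbertDist_le_iff hu hv).1 le_rfl).symm h.isSharpCone (Real.exp_pos _)

theorem hilbertDist_triangle (h : IsConvexInPatch Ω φ) (ha : a ∈ Ω) (hb : b ∈ Ω) (hc : c ∈ Ω) :
    hilbertDist Ω a c ≤ hilbertDist Ω a b + hilbertDist Ω b c := by
  obtain ⟨u, hu, rfl⟩ := h.exists_mk_eq ha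
  obtain ⟨v, hv, rfl⟩ := h.exists_mk_eq hb
  obtain ⟨w, hw, rfl⟩ := h.exists_mk_eq hc
  rw [h.hilbertDist_le_iff hu hw, Real.exp_add]
  exact ((h.hilbertDist_le_iff hu hv).1 le_rfl).trans h.isSharpCone (Real.exp_pos _).le
    ((h.hilbertDist_le_iff hv hw).1 le_rfl)

theorem exists_midpoint (h : IsConvexInPatch Ω φ) (ha : a ∈ Ω) (hb : b ∈ Ω) :
    ∃ m ∈ Ω, hilbertDist Ω a m ≤ hilbertDist Ω a b / 2 ∧
      hilbertDist Ω m b ≤ hilbertDist Ω a b / 2 := by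
  obtain ⟨u, hu, rfl⟩ := h.exists_mk_eq ha
  obtain ⟨v, hv, rfl⟩ := h.exists_mk_eq hb
  set r := hilbertDist Ω (Projectivization.mk ℝ u hu.2.1) (Projectivization.mk ℝ v hv.2.1) with hr
  have h1 := (h.hilbertDist_le_iff hu hv).1 hr.ge
  have hsq : Real.exp r = Real.exp (r / 2) ^ 2 := by
    rw [← Real.exp_nat_mul]
    congr 1
    push_cast
    ring
  rw [hsq] at h1
  obtain ⟨m, hm, h2, h3⟩ := h1.exists_midpoint h.isSharpCone hu hv (Real.exp_pos _)
  exact ⟨_, hm.2.2, (h.hilbertDist_le_iff hu hm).2 h2, (h.hilbertDist_le_iff hm hv).2 h3⟩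

/-- Uniform total boundedness of the balls of all Hilbert geometries of dimension `n`. -/
theorem _root_.ConvexProjective.exists_hilbertDist_le_of_many (n : ℕ) (R : ℝ) {ε : ℝ}
    (hε : 0 < ε) :
    ∃ N : ℕ, ∀ (Ω : Set (RP n)) (φ : Module.Dual ℝ (Fin (n + 1) → ℝ)), IsConvexInPatch Ω φ →
      ∀ a ∈ Ω, ∀ x : Fin (N + 1) → RP n, (∀ k, x k ∈ Ω) → (∀ k, hilbertDist Ω a (x k) ≤ R) →
        ∃ i j, i < j ∧ hilbertDist Ω (x i) (x j) ≤ ε := by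
  obtain ⟨N, hN⟩ := exists_orderBound_of_many (Fin (n + 1) → ℝ) (Real.exp_pos R)
    (Real.one_lt_exp_iff.2 hε)
  refine ⟨N, fun Ω φ h a ha x hx hxR => ?_⟩
  obtain ⟨u, hu, rfl⟩ := h.exists_mk_eq ha
  choose y hy hyx using fun k => h.exists_mk_eq (hx k)
  obtain ⟨i, j, hij, hb⟩ := hN _ φ h.isSharpCone u hu y fun k => by
    rw [← h.hilbertDist_le_iff hu (hy k), hyx k]
    exact hxR k
  refine ⟨i, j, hij, ?_⟩
  rw [← hyx i, ← hyx j, h.hilbertDist_le_iff (hy i) (hy j)]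
  exact hb

end IsConvexInPatch

end HilbertMetric

/-! ### Lifts of projective transformations and compactness -/

section Lifts

open scoped Matrix Pointwise
open Topology

variable {n : ℕ} {Ω : Set (RP n)} {φ : Module.Dual ℝ (Fin (n + 1) → ℝ)}
  {u v w : Fin (n + 1) → ℝ} {a b : RP n} {γ : PGL n}

theorem mulVec_ne_zero (g : Matrix.GeneralLinearGroup (Fin (n + 1)) ℝ) (hv : v ≠ 0) :
    g.1 *ᵥ v ≠ 0 := by
  intro h
  apply hv
  have : g⁻¹.1 *ᵥ (g.1 *ᵥ v) = v := by
    rw [Matrix.mulVec_mulVec, ← Units.val_mul, inv_mul_cancel, Units.val_one, Matrix.one_mulVec]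
  rw [← this, h, Matrix.mulVec_zero]

theorem mk_smul_mk (g : Matrix.GeneralLinearGroup (Fin (n + 1)) ℝ) (hv : v ≠ 0) :
    Matrix.ProjGenLinGroup.mk g • Projectivization.mk ℝ v hv =
      Projectivization.mk ℝ (g.1 *ᵥ v) (mulVec_ne_zero g hv) :=
  rfl

/-- `γ` maps `Ω` onto itself. -/
def Preserves (γ : PGL n) (Ω : Set (RP n)) : Prop :=
  (∀ p ∈ Ω, γ • p ∈ Ω) ∧ ∀ p ∈ Ω, γ⁻¹ • p ∈ Ω

theorem Preserves.inv (hγ : Preserves γ Ω) : Preserves γ⁻¹ Ω :=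
  ⟨hγ.2, by simpa using hγ.1⟩

/-- `g` maps `C` onto itself. -/
def PreservesCone (g : Matrix.GeneralLinearGroup (Fin (n + 1)) ℝ) (C : Set (Fin (n + 1) → ℝ)) :
    Prop :=
  (∀ v ∈ C, g.1 *ᵥ v ∈ C) ∧ ∀ v ∈ C, g⁻¹.1 *ᵥ v ∈ C

theorem mulVec_mem_closure {A : Matrix (Fin (n + 1)) (Fin (n + 1)) ℝ} {C : Set (Fin (n + 1) → ℝ)}
    (hA : ∀ v ∈ C, A *ᵥ v ∈ C) (hv : v ∈ closure C) : A *ᵥ v ∈ closure C :=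
  map_mem_closure (continuous_const.matrix_mulVec continuous_id) hv hA

theorem exists_unit_smul (g : Matrix.GeneralLinearGroup (Fin (n + 1)) ℝ) {s : ℝ} (hs : s ≠ 0) :
    ∃ g' : Matrix.GeneralLinearGroup (Fin (n + 1)) ℝ,
      Matrix.ProjGenLinGroup.mk g' = Matrix.ProjGenLinGroup.mk g ∧ g'.1 = s • g.1 ∧
        g'⁻¹.1 = s⁻¹ • g⁻¹.1 := by
  refine ⟨⟨s • g.1, s⁻¹ • g⁻¹.1, ?_, ?_⟩, ?_, rfl, rfl⟩
  · rw [smul_mul_smul_comm, mul_inv_cancel₀ hs, one_smul, ← Units.val_mul, mul_inv_cancel,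
      Units.val_one]
  · rw [smul_mul_smul_comm, inv_mul_cancel₀ hs, one_smul, ← Units.val_mul, inv_mul_cancel,
      Units.val_one]
  · rw [eq_comm, Matrix.ProjGenLinGroup.mk_eq_mk_iff]
    refine ⟨Units.mk0 s hs, ?_⟩
    ext i j
    simp [mul_comm]

theorem PreservesCone.smul {C : Set (Fin (n + 1) → ℝ)} (hC : IsSharpCone C φ)
    {g g' : Matrix.GeneralLinearGroup (Fin (n + 1)) ℝ} (hg : PreservesCone g C) {s : ℝ}
    (hs : 0 < s) (h : g'.1 = s • g.1) (h' : g'⁻¹.1 = s⁻¹ • g⁻¹.1) : PreservesCone g' C := by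
  refine ⟨fun v hv => ?_, fun v hv => ?_⟩
  · rw [h, Matrix.smul_mulVec]
    exact hC.smul_mem s hs _ (hg.1 v hv)
  · rw [h', Matrix.smul_mulVec]
    exact hC.smul_mem _ (inv_pos.2 hs) _ (hg.2 v hv)

namespace IsConvexInPatch

/-- For any matrix `g` of `γ`, the functional `φ ∘ g` has no zero on the cone, so it has constant
sign there; either `g` or `-g` works. -/
theorem exists_lift (h : IsConvexInPatch Ω φ) (hγ : Preserves γ Ω) :
    ∃ g : Matrix.GeneralLinearGroup (Fin (n + 1)) ℝ,
      Matrix.ProjGenLinGroup.mk g = γ ∧ PreservesCone g (coneOver φ Ω) := by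
  have key : ∀ g : Matrix.GeneralLinearGroup (Fin (n + 1)) ℝ,
      Preserves (Matrix.ProjGenLinGroup.mk g) Ω → (∀ v ∈ coneOver φ Ω, 0 < φ (g.1 *ᵥ v)) →
      PreservesCone g (coneOver φ Ω) := by
    intro g hg hpos
    have h1 : ∀ v ∈ coneOver φ Ω, g.1 *ᵥ v ∈ coneOver φ Ω := fun v hv =>
      ⟨hpos v hv, mulVec_ne_zero g hv.2.1, hg.1 _ hv.2.2⟩
    refine ⟨h1, fun v hv => ?_⟩
    have hΩ : Projectivization.mk ℝ (g⁻¹.1 *ᵥ v) (mulVec_ne_zero g⁻¹ hv.2.1) ∈ Ω := by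
      have := hg.2 _ hv.2.2
      rwa [← map_inv, mk_smul_mk] at this
    have hne : φ (g⁻¹.1 *ᵥ v) ≠ 0 :=
      (mk_mem_affinePatch _).1 (h.closure_subset (subset_closure hΩ))
    rcases lt_or_gt_of_ne hne with hlt | hgt
    · exfalso
      have hneg : (-1 : ℝ) • (g⁻¹.1 *ᵥ v) ∈ coneOver φ Ω := by
        refine ⟨by rw [map_smul, smul_eq_mul]; linarith,
          smul_ne_zero (by norm_num) (mulVec_ne_zero g⁻¹ hv.2.1), ?_⟩
        rw [mk_smul_eq (by norm_num) (mulVec_ne_zero g⁻¹ hv.2.1)]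
        exact hΩ
      have := (h1 _ hneg).1
      rw [Matrix.mulVec_smul, Matrix.mulVec_mulVec, ← Units.val_mul, mul_inv_cancel, Units.val_one,
        Matrix.one_mulVec, map_smul, smul_eq_mul] at this
      linarith [hv.1]
    · exact ⟨hgt, _, hΩ⟩
  obtain ⟨g, rfl⟩ := Matrix.ProjGenLinGroup.mk_surjective γ
  have hne : ∀ v ∈ coneOver φ Ω, (φ ∘ₗ g.1.mulVecLin) v ≠ 0 := fun v hv =>
    (mk_mem_affinePatch (mulVec_ne_zero g hv.2.1)).1
      (h.closure_subset (subset_closure (hγ.1 _ hv.2.2)))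
  rcases h.isSharpCone.pos_or_neg hne with hpos | hneg
  · exact ⟨g, rfl, key g hγ hpos⟩
  · obtain ⟨g', hg', h1, -⟩ := exists_unit_smul g (show (-1 : ℝ) ≠ 0 by norm_num)
    refine ⟨g', hg', key g' (by rwa [hg']) fun v hv => ?_⟩
    have := hneg v hv
    rw [LinearMap.comp_apply, Matrix.mulVecLin_apply] at this
    rw [h1, Matrix.smul_mulVec, map_smul, smul_eq_mul]
    linarith

theorem hilbertDist_smul (h : IsConvexInPatch Ω φ) (hγ : Preserves γ Ω) (ha : a ∈ Ω)
    (hb : b ∈ Ω) : hilbertDist Ω (γ • a) (γ • b) = hilbertDist Ω a b := by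
  have key : ∀ γ : PGL n, Preserves γ Ω → ∀ a ∈ Ω, ∀ b ∈ Ω,
      hilbertDist Ω (γ • a) (γ • b) ≤ hilbertDist Ω a b := by
    intro γ hγ a ha b hb
    obtain ⟨g, rfl, hg, -⟩ := h.exists_lift hγ
    obtain ⟨u, hu, rfl⟩ := h.exists_mk_eq ha
    obtain ⟨v, hv, rfl⟩ := h.exists_mk_eq hb
    refine (h.hilbertDist_le_iff (hg u hu) (hg v hv)).2 ?_
    exact OrderBound.map (g := LinearMap.toContinuousLinearMap g.1.mulVecLin) hg
      ((h.hilbertDist_le_iff hu hv).1 le_rfl)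
  refine le_antisymm (key γ hγ a ha b hb) ?_
  have := key γ⁻¹ hγ.inv _ (hγ.1 a ha) _ (hγ.1 b hb)
  rwa [inv_smul_smul, inv_smul_smul] at this

end IsConvexInPatch

/-- The map `g ↦ (g, g⁻¹)` is a closed embedding into pairs of matrices, which is why the inverse
must be bounded too. -/
theorem isCompact_setOf_entries_le (B : ℝ) :
    IsCompact {g : Matrix.GeneralLinearGroup (Fin (n + 1)) ℝ |
      ∀ i j, |g.1 i j| ≤ B ∧ |g⁻¹.1 i j| ≤ B} := by
  have hbox : IsCompact {A : Matrix (Fin (n + 1)) (Fin (n + 1)) ℝ | ∀ i j, |A i j| ≤ B} := by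
    have := isCompact_univ_pi fun i : Fin (n + 1) =>
      isCompact_univ_pi fun j : Fin (n + 1) => isCompact_Icc (a := -B) (b := B)
    refine (congrArg IsCompact (Set.ext fun A => ?_)).mpr this
    exact ⟨fun h i _ j _ => abs_le.1 (h i j), fun h i j => abs_le.2 (h i trivial j trivial)⟩
  have hprod := (hbox.prod (hbox.image MulOpposite.continuous_op))
  convert Units.isClosedEmbedding_embedProduct.isCompact_preimage hprod using 1
  ext g
  constructor
  · intro hg
    exact ⟨fun i j => (hg i j).1, ⟨_, fun i j => (hg i j).2, rfl⟩⟩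
  · rintro ⟨h1, A, h2, h3⟩ i j
    refine ⟨h1 i j, ?_⟩
    have : A = g⁻¹.1 := MulOpposite.op_injective h3
    rw [← this]
    exact h2 i j

/-- Pigeonhole on a finite cover of `K` by translates `x V` with `V⁻¹ V ⊆ U`. -/
theorem exists_inv_mul_mem_of_many {G : Type*} [Group G] [TopologicalSpace G]
    [IsTopologicalGroup G] {K U : Set G} (hK : IsCompact K) (hU : U ∈ 𝓝 (1 : G)) :
    ∃ N : ℕ, ∀ g : Fin (N + 1) → G, (∀ k, g k ∈ K) → ∃ i j, i < j ∧ (g i)⁻¹ * g j ∈ U := by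
  have hcont : Filter.Tendsto (fun x : G × G => x.1⁻¹ * x.2) (𝓝 (1, 1)) (𝓝 1) := by
    have : Continuous fun x : G × G => x.1⁻¹ * x.2 := by fun_prop
    simpa using this.tendsto (1, 1)
  rw [nhds_prod_eq] at hcont
  obtain ⟨V, hV, hVU⟩ := Filter.mem_prod_self_iff.1 (hcont hU)
  obtain ⟨t, -, ht⟩ := hK.elim_nhds_subcover (fun x => (fun y => x⁻¹ * y) ⁻¹' V) fun x _ =>
    (continuous_const.mul continuous_id).continuousAt.preimage_mem_nhds (by simpa using hV)
  refine ⟨t.card, fun g hg => ?_⟩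
  have hc : ∀ k, ∃ x ∈ t, x⁻¹ * g k ∈ V := fun k => by
    simpa using ht (hg k)
  choose f hf hfV using hc
  obtain ⟨i, -, j, -, hij, hfij⟩ := Finset.exists_ne_map_eq_of_card_lt_of_maps_to
    (s := Finset.univ) (t := t) (by simp) (fun k _ => hf k)
  have key : ∀ i j, f i = f j → (g i)⁻¹ * g j ∈ U := by
    intro i j h
    have := hVU (Set.mk_mem_prod (hfV i) (hfV j))
    simpa [h, mul_assoc] using this
  rcases lt_or_gt_of_ne hij with h | h
  · exact ⟨i, j, h, key i j hfij⟩
  · exact ⟨j, i, h, key j i hfij.symm⟩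

/-- The order interval contains a ball about `0` and is bounded, so it serves as the unit ball of a
norm equivalent to the given one. -/
theorem IsSharpCone.exists_entry_le {C : Set (Fin (n + 1) → ℝ)} (hC : IsSharpCone C φ)
    (hu : u ∈ C) (c : ℝ) :
    ∃ B : ℝ, ∀ A : Matrix (Fin (n + 1)) (Fin (n + 1)) ℝ,
      (∀ x ∈ orderInterval C u, A *ᵥ x ∈ c • orderInterval C u) → ∀ i j, |A i j| ≤ B := by
  obtain ⟨ρ, hρ, hball⟩ := Metric.nhds_basis_closedBall.mem_iff.1 (hC.orderInterval_mem_nhds hu)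
  obtain ⟨B, hB⟩ := ((hC.isBounded_orderInterval (u := u)).smul₀ c).exists_norm_le
  refine ⟨B / ρ, fun A hA i j => ?_⟩
  have h1 : ρ • (Pi.single j 1 : Fin (n + 1) → ℝ) ∈ orderInterval C u := by
    refine hball ?_
    rw [mem_closedBall_zero_iff, norm_smul, Real.norm_of_nonneg hρ.le, Pi.norm_single,
      norm_one, mul_one]
  have h2 := (norm_le_pi_norm _ i).trans (hB _ (hA _ h1))
  rw [Matrix.mulVec_smul, Matrix.mulVec_single_one, Pi.smul_apply, norm_smul,
    Real.norm_of_nonneg hρ.le] at h2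
  rw [le_div_iff₀ hρ, mul_comm]
  exact h2

/-- The projective transformations that preserve `Ω` and move a point of `Ω` by a bounded distance
are relatively compact. -/
theorem IsConvexInPatch.exists_inv_mul_mem_of_many (h : IsConvexInPatch Ω φ) (ha : a ∈ Ω)
    {U : Set (PGL n)} (hU : IsOpen U) (hU1 : 1 ∈ U) (R : ℝ) :
    ∃ N : ℕ, ∀ γ : Fin (N + 1) → PGL n, (∀ k, Preserves (γ k) Ω) →
      (∀ k, hilbertDist Ω a (γ k • a) ≤ R) → ∃ i j, i < j ∧ (γ i)⁻¹ * γ j ∈ U := by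
  obtain ⟨u, hu, rfl⟩ := h.exists_mk_eq ha
  have hC := h.isSharpCone
  obtain ⟨B₁, hB₁⟩ := hC.exists_entry_le hu (Real.exp R)
  obtain ⟨B₂, hB₂⟩ := hC.exists_entry_le hu 1
  have hU' : IsOpen ((fun g : Matrix.GeneralLinearGroup (Fin (n + 1)) ℝ =>
      Matrix.ProjGenLinGroup.mk g) ⁻¹' U) := isOpen_coinduced.1 hU
  obtain ⟨N, hN⟩ := ConvexProjective.exists_inv_mul_mem_of_many
    (isCompact_setOf_entries_le (n := n) (max B₁ B₂)) (hU'.mem_nhds (by simpa using hU1))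
  refine ⟨N, fun γ hγ hR => ?_⟩
  have hlift : ∀ k, ∃ g : Matrix.GeneralLinearGroup (Fin (n + 1)) ℝ,
      Matrix.ProjGenLinGroup.mk g = γ k ∧ ∀ i j, |g.1 i j| ≤ max B₁ B₂ ∧
        |g⁻¹.1 i j| ≤ max B₁ B₂ := by
    intro k
    obtain ⟨g, hg, hgC⟩ := h.exists_lift (hγ k)
    have hRk := hR k
    rw [← hg] at hRk
    obtain ⟨s, hs, h1, h2⟩ := (h.hilbertDist_le_iff hu (hgC.1 u hu)).1 hRk
    -- Rescaled by `s`, the lift satisfies `u ≤ g' u ≤ e^R u`. Hence `g'` maps `[-u, u]` into `e^R •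
    -- [-u, u]`, and `g'⁻¹ u ≤ u` makes `g'⁻¹` map `[-u, u]` into itself.
    obtain ⟨g', hg', hgs, hgs'⟩ := exists_unit_smul g hs.ne'
    have hgC' := hgC.smul hC hs hgs hgs'
    rw [← Matrix.smul_mulVec, ← hgs] at h1 h2
    have h3 : u - g'⁻¹.1 *ᵥ u ∈ closure (coneOver φ Ω) := by
      have := mulVec_mem_closure hgC'.2 h1
      rwa [Matrix.mulVec_sub, Matrix.mulVec_mulVec, ← Units.val_mul, inv_mul_cancel, Units.val_one,
        Matrix.one_mulVec] at this
    refine ⟨g', hg'.trans hg, fun i j => ⟨(hB₁ _ (fun x hx => ?_) i j).trans (le_max_left _ _),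
      (hB₂ _ (fun x hx => ?_) i j).trans (le_max_right _ _)⟩⟩
    · rw [mem_smul_orderInterval hC (Real.exp_pos R)]
      constructor
      · convert hC.closure_add h2 (mulVec_mem_closure hgC'.1 hx.1) using 1
        rw [Matrix.mulVec_sub]
        abel
      · convert hC.closure_add h2 (mulVec_mem_closure hgC'.1 hx.2) using 1
        rw [Matrix.mulVec_add]
        abel
    · rw [one_smul]
      constructor
      · convert hC.closure_add h3 (mulVec_mem_closure hgC'.2 hx.1) using 1
        rw [Matrix.mulVec_sub]
        abel
      · convert hC.closure_add h3 (mulVec_mem_closure hgC'.2 hx.2) using 1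
        rw [Matrix.mulVec_add]
        abel
  choose g hg hgB using hlift
  obtain ⟨i, j, hij, hmem⟩ := hN g hgB
  refine ⟨i, j, hij, ?_⟩
  rw [← hg i, ← hg j, ← map_inv, ← map_mul]
  exact hmem

end Lifts

/-! ### Displacements and the injectivity radius -/

namespace ProperlyConvexManifold

variable {n : ℕ} (M : ProperlyConvexManifold n) {γ : PGL n} {a b : RP n} {p q : M.Point} {r : ℝ}

theorem exists_isConvexInPatch : ∃ φ, IsConvexInPatch M.Ω φ := by
  obtain ⟨hconv, φ, -, hφ⟩ := M.isProperlyConvex_Ω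
  exact ⟨φ, M.isOpen_Ω, hconv, hφ⟩

theorem preserves (hγ : γ ∈ M.Γ) : Preserves γ M.Ω :=
  ⟨M.smul_mem γ hγ, M.smul_mem _ (M.Γ.inv_mem hγ)⟩

theorem hilbertDist_smul (hγ : γ ∈ M.Γ) (ha : a ∈ M.Ω) (hb : b ∈ M.Ω) :
    hilbertDist M.Ω (γ • a) (γ • b) = hilbertDist M.Ω a b := by
  obtain ⟨φ, h⟩ := M.exists_isConvexInPatch
  exact h.hilbertDist_smul (M.preserves hγ) ha hb

theorem hilbertDist_pow_smul_le (hγ : γ ∈ M.Γ) (ha : a ∈ M.Ω) (k : ℕ) :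
    hilbertDist M.Ω a (γ ^ k • a) ≤ k * hilbertDist M.Ω a (γ • a) := by
  obtain ⟨φ, h⟩ := M.exists_isConvexInPatch
  induction k with
  | zero => simp [hilbertDist]
  | succ k ih =>
    have hk := M.Γ.pow_mem hγ k
    have h1 := h.hilbertDist_triangle ha (M.smul_mem _ hk a ha)
      (M.smul_mem _ (M.Γ.pow_mem hγ (k + 1)) a ha)
    rw [pow_succ, mul_smul, M.hilbertDist_smul hk ha (M.smul_mem γ hγ a ha)] at h1
    rw [pow_succ, mul_smul]
    push_cast
    linarith

theorem pow_ne_one (hγ : γ ∈ M.Γ) (h1 : γ ≠ 1) {m : ℕ} (hm : 0 < m) : γ ^ m ≠ 1 :=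
  fun h => h1 (M.torsionFree γ hγ (isOfFinOrder_iff_pow_eq_one.2 ⟨m, hm, h⟩))

theorem inv_pow_mul_pow {i j : ℕ} (hij : i ≤ j) : (γ ^ i)⁻¹ * γ ^ j = γ ^ (j - i) := by
  rw [inv_mul_eq_iff_eq_mul, ← pow_add, Nat.add_sub_cancel' hij]

/-- The displacements of a point by the nontrivial elements of `Γ` are bounded away from zero. -/
theorem exists_le_hilbertDist_smul (ha : a ∈ M.Ω) :
    ∃ ε : ℝ, 0 < ε ∧ ∀ γ ∈ M.Γ, γ ≠ 1 → ε ≤ hilbertDist M.Ω a (γ • a) := by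
  obtain ⟨φ, h⟩ := M.exists_isConvexInPatch
  have := M.discrete
  obtain ⟨U, hU, hU1⟩ := isOpen_induced_iff.1 (isOpen_discrete ({1} : Set M.Γ))
  have hmem : ∀ γ ∈ M.Γ, γ ∈ U ↔ γ = 1 := by
    intro γ hγ
    have := Set.ext_iff.1 hU1 ⟨γ, hγ⟩
    simpa [Subtype.ext_iff] using this
  obtain ⟨N, hN⟩ := h.exists_inv_mul_mem_of_many ha hU ((hmem 1 M.Γ.one_mem).2 rfl) 1
  -- A smaller displacement keeps `γ ^ k • a` within `1` of `a` for all `k ≤ N`. Two of these powers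
  -- then differ by an element of `U ∩ Γ = {1}`, which gives torsion.
  refine ⟨1 / (N + 1), by positivity, fun γ hγ h1 => ?_⟩
  by_contra! hlt
  rw [lt_div_iff₀ (by positivity)] at hlt
  have h0 := h.hilbertDist_nonneg ha (M.smul_mem γ hγ a ha)
  obtain ⟨i, j, hij, hU⟩ := hN (fun k => γ ^ (k : ℕ))
    (fun k => M.preserves (M.Γ.pow_mem hγ _)) fun k => by
      refine (M.hilbertDist_pow_smul_le hγ ha k).trans ?_
      have : ((k : ℕ) : ℝ) ≤ N + 1 := by exact_mod_cast k.2.le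
      nlinarith
  rw [inv_pow_mul_pow hij.le, hmem _ (M.Γ.pow_mem hγ _)] at hU
  exact M.pow_ne_one hγ h1 (Nat.sub_pos_of_lt hij) hU

theorem smul_ne (hγ : γ ∈ M.Γ) (h1 : γ ≠ 1) (ha : a ∈ M.Ω) : γ • a ≠ a := by
  intro h
  obtain ⟨ε, hε, hle⟩ := M.exists_le_hilbertDist_smul ha
  have := hle γ hγ h1
  rw [h, hilbertDist, if_pos rfl] at this
  linarith

theorem proj_eq_iff {a b : M.Ω} : M.proj a = M.proj b ↔ ∃ γ ∈ M.Γ, γ • (a : RP n) = b :=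
  Quotient.eq (r := M.orbitSetoid)

theorem exists_proj_eq (p : M.Point) : ∃ a : M.Ω, M.proj a = p :=
  Quotient.exists_rep p

/-- The radius of an embedded ball is at most half of each displacement of its centre. -/
theorem IsEmbeddedBall.two_mul_le {a : M.Ω} (h : M.IsEmbeddedBall (M.proj a) r) (hγ : γ ∈ M.Γ)
    (h1 : γ ≠ 1) : 2 * r ≤ hilbertDist M.Ω a (γ • (a : RP n)) := by
  obtain ⟨φ, hΩ⟩ := M.exists_isConvexInPatch
  by_contra! hlt
  have hγa := M.smul_mem γ hγ a a.2
  -- Both `m` and `γ⁻¹ • m` lie within `r` of `a` and have the same projection. Injectivity makes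
  -- them equal, but the action has no fixed points.
  obtain ⟨m, hm, hm1, hm2⟩ := hΩ.exists_midpoint a.2 hγa
  have hγ' := M.Γ.inv_mem hγ
  have hm' := M.smul_mem _ hγ' m hm
  have h2 : hilbertDist M.Ω a (γ⁻¹ • m) < r := by
    rw [← M.hilbertDist_smul hγ a.2 hm', smul_inv_smul, hΩ.hilbertDist_comm hγa hm]
    linarith
  have h3 : (⟨m, hm⟩ : M.Ω) = ⟨γ⁻¹ • m, hm'⟩ := h a rfl
    (show hilbertDist M.Ω a m < r by linarith) h2 (M.proj_eq_iff.2 ⟨γ⁻¹, hγ', rfl⟩)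
  exact M.smul_ne hγ' (inv_ne_one.2 h1) hm (Subtype.ext_iff.1 h3).symm

/-- If `c = γ b` with `b, c` in the ball about `a'`, then `a'` is moved by at most `d(a', c) + d(γ
b, γ a') < 2r`. Conjugation by `η` carries the hypothesis from `a` to the other lift `a'`. -/
theorem isEmbeddedBall_of_le {a : M.Ω}
    (h : ∀ γ ∈ M.Γ, γ ≠ 1 → 2 * r ≤ hilbertDist M.Ω a (γ • (a : RP n))) :
    M.IsEmbeddedBall (M.proj a) r := by
  obtain ⟨φ, hΩ⟩ := M.exists_isConvexInPatch
  intro a' ha' b hb c hc hbc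
  obtain ⟨η, hη, haη⟩ := M.proj_eq_iff.1 ha'
  obtain ⟨γ, hγ, hγb⟩ := M.proj_eq_iff.1 hbc
  by_contra hne
  have h1 : γ ≠ 1 := by
    rintro rfl
    rw [one_smul] at hγb
    exact hne (Subtype.ext hγb)
  have hγ' : η * γ * η⁻¹ ∈ M.Γ := M.Γ.mul_mem (M.Γ.mul_mem hη hγ) (M.Γ.inv_mem hη)
  have h2 := h _ hγ' (by rwa [ne_eq, conj_eq_one_iff])
  have hγa := M.smul_mem γ hγ _ a'.2
  rw [← haη, mul_smul, mul_smul, inv_smul_smul, M.hilbertDist_smul hη a'.2 hγa] at h2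
  have h3 := hΩ.hilbertDist_triangle a'.2 c.2 hγa
  rw [← hγb, hΩ.hilbertDist_comm (M.smul_mem γ hγ _ b.2) hγa, M.hilbertDist_smul hγ a'.2 b.2,
    hγb] at h3
  have hb' : hilbertDist M.Ω a' b < r := hb
  have hc' : hilbertDist M.Ω a' c < r := hc
  linarith

theorem inj_le {a : M.Ω} (hγ : γ ∈ M.Γ) (h1 : γ ≠ 1) :
    M.inj (M.proj a) ≤ ENNReal.ofReal (hilbertDist M.Ω a (γ • (a : RP n)) / 2) := by
  refine iSup₂_le fun r hr => ?_
  rw [← ENNReal.ofReal_coe_nnreal]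
  refine ENNReal.ofReal_le_ofReal ?_
  linarith [hr.two_mul_le M hγ h1]

theorem le_inj {a : M.Ω}
    (h : ∀ γ ∈ M.Γ, γ ≠ 1 → 2 * r ≤ hilbertDist M.Ω a (γ • (a : RP n))) :
    ENNReal.ofReal r ≤ M.inj (M.proj a) := by
  rcases le_total r 0 with hr | hr
  · rw [ENNReal.ofReal_of_nonpos hr]
    exact zero_le
  · exact le_iSup₂_of_le (f := fun (r : ℝ≥0) (_ : M.IsEmbeddedBall (M.proj a) r) => (r : ℝ≥0∞))
      r.toNNReal (by
        rw [Real.coe_toNNReal r hr]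
        exact M.isEmbeddedBall_of_le h) le_rfl

theorem inj_pos (p : M.Point) : 0 < M.inj p := by
  obtain ⟨a, rfl⟩ := M.exists_proj_eq p
  obtain ⟨ε, hε, h⟩ := M.exists_le_hilbertDist_smul a.2
  refine lt_of_lt_of_le (ENNReal.ofReal_pos.2 (half_pos hε)) (M.le_inj fun γ hγ h1 => ?_)
  linarith [h γ hγ h1]

/-- The condition on the right does not involve `p`; this settles the infinite case of the theorem.
-/
theorem inj_eq_top_iff (p : M.Point) : M.inj p = ⊤ ↔ ∀ γ ∈ M.Γ, γ = 1 := by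
  obtain ⟨a, rfl⟩ := M.exists_proj_eq p
  constructor
  · intro h γ hγ
    by_contra h1
    have := M.inj_le (a := a) hγ h1
    rw [h, top_le_iff] at this
    exact ENNReal.ofReal_ne_top this
  · intro h
    refine ENNReal.eq_top_of_forall_nnreal_le fun r => ?_
    rw [← ENNReal.ofReal_coe_nnreal]
    exact M.le_inj fun γ hγ h1 => absurd (h γ hγ) h1

theorem dist_nonneg (p q : M.Point) : 0 ≤ M.dist p q := by
  obtain ⟨φ, h⟩ := M.exists_isConvexInPatch
  refine Real.sInf_nonneg ?_
  rintro _ ⟨a, b, -, -, rfl⟩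
  exact h.hilbertDist_nonneg a.2 b.2

/-- A lower bound for the injectivity radius at points of a ball, uniform in the manifold. -/
theorem exists_le_inj (n : ℕ) {ℓ : ℝ} (hℓ : 0 < ℓ) (D : ℝ) :
    ∃ δ : ℝ, 0 < δ ∧ ∀ (M : ProperlyConvexManifold n) (p q : M.Point),
      ENNReal.ofReal ℓ ≤ M.inj p → M.dist p q ≤ D → ENNReal.ofReal δ ≤ M.inj q := by
  -- One unit allows for lifts that only nearly realise the infimum `M.dist p q`, the other for the
  -- displacement of `b` by `γ ^ k` with `k ≤ N`.
  obtain ⟨N, hN⟩ := exists_hilbertDist_le_of_many n (D + 2) hℓ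
  refine ⟨1 / (2 * (N + 1)), by positivity, fun M p q hp hD => ?_⟩
  obtain ⟨φ, hΩ⟩ := M.exists_isConvexInPatch
  obtain ⟨_, ⟨a, b, rfl, rfl, rfl⟩, hab⟩ := exists_lt_of_csInf_lt
    (by
      obtain ⟨a, ha⟩ := M.exists_proj_eq p
      obtain ⟨b, hb⟩ := M.exists_proj_eq q
      exact ⟨_, a, b, ha, hb, rfl⟩) (lt_of_le_of_lt hD (lt_add_one D))
  refine M.le_inj fun γ hγ h1 => ?_
  by_contra! hlt
  rw [show 2 * (1 / (2 * ((N : ℝ) + 1))) = 1 / (N + 1) by field_simp,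
    lt_div_iff₀ (by positivity)] at hlt
  have h0 := hΩ.hilbertDist_nonneg b.2 (M.smul_mem γ hγ b b.2)
  have hmem : ∀ (k : ℕ) (c : M.Ω), γ ^ k • (c : RP n) ∈ M.Ω := fun k c =>
    M.smul_mem _ (M.Γ.pow_mem hγ k) c c.2
  obtain ⟨i, j, hij, hle⟩ := hN M.Ω φ hΩ b b.2 (fun k => γ ^ (k : ℕ) • (a : RP n))
    (fun k => hmem k a) fun k => by
      have h2 := hΩ.hilbertDist_triangle b.2 (hmem k b) (hmem k a)
      rw [M.hilbertDist_smul (M.Γ.pow_mem hγ k) b.2 a.2, hΩ.hilbertDist_comm b.2 a.2] at h2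
      have h3 := M.hilbertDist_pow_smul_le hγ b.2 k
      have h4 : ((k : ℕ) : ℝ) ≤ N + 1 := by exact_mod_cast k.2.le
      nlinarith
  have hi := M.Γ.pow_mem hγ (i : ℕ)
  have hm := M.Γ.pow_mem hγ ((j : ℕ) - i)
  have hj : γ ^ (j : ℕ) • (a : RP n) = γ ^ (i : ℕ) • γ ^ ((j : ℕ) - i) • (a : RP n) := by
    rw [← mul_smul, ← pow_add, Nat.add_sub_cancel' (Fin.le_def.1 hij.le)]
  have hle' : hilbertDist M.Ω (γ ^ (i : ℕ) • (a : RP n)) (γ ^ (j : ℕ) • (a : RP n)) ≤ ℓ := hle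
  rw [hj, M.hilbertDist_smul hi a.2 (M.smul_mem _ hm a a.2)] at hle'
  -- A displacement of at most `ℓ` at `a` yields `ℓ ≤ inj p ≤ ℓ / 2`, which is absurd.
  have h5 := hp.trans (M.inj_le (a := a) hm (M.pow_ne_one hγ h1 (Nat.sub_pos_of_lt hij)))
  have h6 := hΩ.hilbertDist_nonneg a.2 (M.smul_mem _ hm a a.2)
  rw [ENNReal.ofReal_le_ofReal_iff (by linarith)] at h5
  linarith

end ProperlyConvexManifold

end ConvexProjective

end

/-! ### Assembling the comparison function -/

theorem mainTheorem9 (n : ℕ) (hn : 2 ≤ n) :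
    ∃ f : ℝ → ℝ → ℝ,
      (∀ r : ℝ, 0 < r → ∀ d : ℝ, 0 ≤ d → 0 < f r d) ∧
      (∀ r : ℝ, 0 < r → StrictAntiOn (f r) (Set.Ici 0)) ∧
      ∀ (M : ConvexProjective.ProperlyConvexManifold n) (p q : M.Point),
        (M.inj p = ⊤ → M.inj q = ⊤) ∧
        (M.inj p ≠ ⊤ → ENNReal.ofReal (f (M.inj p).toReal (M.dist p q)) < M.inj q) := by
  have key : ∀ (ℓ : ℝ) (k : ℕ), ∃ δ : ℝ, 0 < δ ∧ (0 < ℓ →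
      ∀ (M : ConvexProjective.ProperlyConvexManifold n) (p q : M.Point),
        ENNReal.ofReal ℓ ≤ M.inj p → M.dist p q ≤ k → ENNReal.ofReal δ ≤ M.inj q) := by
    intro ℓ k
    by_cases hℓ : 0 < ℓ
    · obtain ⟨δ, hδ, h⟩ := ConvexProjective.ProperlyConvexManifold.exists_le_inj n hℓ k
      exact ⟨δ, hδ, fun _ => h⟩
    -- An arbitrary positive value for `ℓ ≤ 0`, so that `δ` is defined everywhere.
    · exact ⟨1, one_pos, fun h => absurd h hℓ⟩
  choose δ hδ hinj using key
  -- The bounds `δ ℓ k` need not be monotone in `k`. Summing reciprocals up to and including `⌈d⌉₊`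
  -- gives a monotone function that dominates `(δ ℓ ⌈d⌉₊)⁻¹`.
  let S : ℝ → ℝ → ℝ := fun ℓ d => ∑ j ∈ Finset.range (⌈d⌉₊ + 1), (δ ℓ j)⁻¹
  have hS : ∀ ℓ d, (δ ℓ ⌈d⌉₊)⁻¹ ≤ S ℓ d := fun ℓ d =>
    Finset.single_le_sum (f := fun j => (δ ℓ j)⁻¹) (fun j _ => (inv_pos.2 (hδ ℓ j)).le)
      (Finset.self_mem_range_succ ⌈d⌉₊)
  have hS0 : ∀ ℓ d, 0 < S ℓ d := fun ℓ d => (inv_pos.2 (hδ ℓ _)).trans_le (hS ℓ d)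
  have hSmono : ∀ ℓ, Monotone (S ℓ) := fun ℓ d e hde =>
    Finset.sum_le_sum_of_subset_of_nonneg
      (Finset.range_mono (Nat.add_le_add_right (Nat.ceil_mono hde) 1))
      fun j _ _ => (inv_pos.2 (hδ ℓ j)).le
  -- The term `d` makes the monotonicity strict, and `1` makes the bound strictly smaller than `δ`,
  -- also at `d = 0`.
  refine ⟨fun ℓ d => (1 + d + S ℓ d)⁻¹, fun ℓ _ d hd => ?_, fun ℓ _ d hd e _ hde => ?_,
    fun M p q => ⟨fun h => ?_, fun h => ?_⟩⟩
  · have := hS0 ℓ d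
    positivity
  · have h1 := hS0 ℓ d
    have h2 := hSmono ℓ hde.le
    have hd' : 0 ≤ d := hd
    exact inv_strictAnti₀ (by positivity) (by linarith)
  · rw [M.inj_eq_top_iff] at h ⊢
    exact h
  · have hℓ : 0 < (M.inj p).toReal := ENNReal.toReal_pos (M.inj_pos p).ne' h
    have hd := M.dist_nonneg p q
    refine lt_of_lt_of_le ?_ (hinj _ ⌈M.dist p q⌉₊ hℓ M p q (ENNReal.ofReal_toReal h).le
      (Nat.le_ceil _))
    rw [ENNReal.ofReal_lt_ofReal_iff (hδ _ _)]
    refine inv_lt_of_inv_lt₀ (hδ _ _) ?_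
    linarith [hS (M.inj p).toReal (M.dist p q)]
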